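/- All manifolds are smooth, finite-dimensional, Hausdorff, second countable and without boundary, and all maps are smooth. Let $\pi:P\to M$ be a surjective submersion, $T^\pi P=\ker d\pi$. A \emph{Pfaffian fibration} $(P,H)$ over $M$ is such a $\pi$ together with a smooth constant-rank distribution $H\subset TP$ with $TP=H+T^\pi P$ and such that the symbol space $\mathfrak g(H):=T^\pi P\cap H$ is Frobenius-involutive. A \emph{Pfaffian morphism} $\phi:(P',H')\to(P,H)$ is a surjective submersion over $M$ with $d\phi(H')\subset H$. Let $$J^1P=\{(p,\zeta)\mid p\in P,\ \zeta:T_{\pi(p)}M\to T_pP\ \text{linear},\ d_p\pi\circ\zeta=\mathrm{id}\}\subset \mathrm{Hom}(\pi^*TM,TP),$$ with its smooth structure as a submanifold of the vector bundle $\mathrm{Hom}(\pi^*TM,TP)$ over $P$; let $\mathrm{pr}:J^1P\to P$, $(p,\zeta)\mapsto p$, and let $\mathcal C\subset TJ^1P$ be the Cartan distribution, the kernel of $\theta_{(p,\zeta)}(X)=d\mathrm{pr}(X)-\zeta\big(d(\pi\circ\mathrm{pr})(X)\big)$. \textbf{Theorem.} Let $(P,H)$ be a Pfaffian fibration over $M$,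 and let $$J^1_HP=\{(p,\zeta)\in J^1P\mid \zeta(T_{\pi(p)}M)\subset H_p\}$$ be its partial prolongation, i.e. the set of its partial integral elements (identified with their splittings $\zeta$). Then: \begin{enumerate} \item $J^1_HP$ is a (Hausdorff, second countable) embedded submanifold of $J^1P$, and $\mathrm{pr}:J^1_HP\to P$ is an affine bundle modelled on the vector bundle $\mathrm{Hom}(\pi^*TM,\mathfrak g(H))$, with $\overrightarrow{\zeta\,\zeta'}=\zeta'-\zeta$. \item With $H^{(1)}:=\mathcal C\cap TJ^1_HP$, the pair $(J^1_HP,H^{(1)})$ is a Pfaffian fibration over $M$, and $\mathrm{pr}:(J^1_HP,H^{(1)})\to(P,H)$ is a Pfaffian morphism. \item $J^1_HP$ is the largest such subbundle: if $P'\subset J^1P$ is an (injectively immersed) submanifold such that $\mathrm{pr}|_{P'}:P'\to P$ is a surjective submersion with $d\mathrm{pr}(\mathcal C\cap TP')\subset H$, then $P'\subset J^1_HP$. \end{enumerate} -/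

import Mathlib

open scoped Manifold ContDiff Topology

noncomputable section

namespace Pfaffian

section VectorSubbundle

variable {EB : Type*} [NormedAddCommGroup EB] [NormedSpace ℝ EB]
  {B : Type*} [TopologicalSpace B] [ChartedSpace EB B]
  {F : Type*} [NormedAddCommGroup F] [NormedSpace ℝ F]
  {V : B → Type*} [TopologicalSpace (Bundle.TotalSpace F V)]
  [∀ b, TopologicalSpace (V b)] [∀ b, AddCommGroup (V b)] [∀ b, Module ℝ (V b)]
  [FiberBundle F V] [VectorBundle ℝ F V]

variable (EB F) in
/-- `e` is a smooth frame over the set `U` of the family of subspaces `S b` of the fibres `V b`: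
its members are smooth sections over `U` and form a basis of `S b` for every `b` in `U`. -/
structure IsSmoothFrameOn (S : ∀ b, Submodule ℝ (V b)) (U : Set B) {k : ℕ}
    (e : Fin k → ∀ b, V b) : Prop where
  smooth : ∀ i, ContMDiffOn 𝓘(ℝ, EB) (𝓘(ℝ, EB).prod 𝓘(ℝ, F)) ∞
    (fun b => (⟨b, e i b⟩ : Bundle.TotalSpace F V)) U
  linearIndependent : ∀ b ∈ U, LinearIndependent ℝ (fun i => e i b)
  span_eq : ∀ b ∈ U, Submodule.span ℝ (Set.range fun i => e i b) = S b

variable (EB F) in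
/-- A smooth vector subbundle (of constant rank) of a vector bundle. -/
def IsVectorSubbundle (S : ∀ b, Submodule ℝ (V b)) : Prop :=
  ∃ k : ℕ, ∀ b₀ : B, ∃ U : Set B, IsOpen U ∧ b₀ ∈ U ∧
    ∃ e : Fin k → ∀ b, V b, IsSmoothFrameOn EB F S U e

variable (EB) in
/-- A subset `A` of the total space of a vector bundle `V → B`, endowed with a smooth structure, is
an affine bundle over `B` modelled on the vector subbundle `S` of `V` (for the
affine structure on its fibres coming from `V`): every fibre of `A` is nonempty and
is a translate of the fibre of `S`, and locally over `B` there are a section `s` of `A` and a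
smooth frame `e` of `S` such that `(b, c) ↦ s b + ∑ i, c i • e i b` is a diffeomorphism from
`U × ℝᵏ` onto the part of `A` over `U`. -/
structure IsAffineBundle (EA : Type*) [NormedAddCommGroup EA] [NormedSpace ℝ EA]
    (A : Set (Bundle.TotalSpace F V)) [ChartedSpace EA A]
    (S : ∀ b, Submodule ℝ (V b)) : Prop where
  isVectorSubbundle : IsVectorSubbundle EB F S
  nonempty : ∀ b, ∃ ξ : V b, (⟨b, ξ⟩ : Bundle.TotalSpace F V) ∈ A
  sub_mem_iff : ∀ b (ξ η : V b), (⟨b, ξ⟩ : Bundle.TotalSpace F V) ∈ A →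
    ((⟨b, η⟩ : Bundle.TotalSpace F V) ∈ A ↔ η - ξ ∈ S b)
  locally_trivial : ∀ b₀ : B, ∃ U : Set B, IsOpen U ∧ b₀ ∈ U ∧
    ∃ (k : ℕ) (s : ∀ b, V b) (e : Fin k → ∀ b, V b), IsSmoothFrameOn EB F S U e ∧
    ∃ Ψ : PartialDiffeomorph (𝓘(ℝ, EB).prod 𝓘(ℝ, Fin k → ℝ)) 𝓘(ℝ, EA)
        (B × (Fin k → ℝ)) A ∞,
      Ψ.source = U ×ˢ Set.univ ∧ Ψ.target = {a : A | a.1.proj ∈ U} ∧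
      ∀ b ∈ U, ∀ c : Fin k → ℝ, (Ψ (b, c)).1 = ⟨b, s b + ∑ i, c i • e i b⟩

end VectorSubbundle

section Fibrations

variable {E' : Type*} [NormedAddCommGroup E'] [NormedSpace ℝ E']
  {P' : Type*} [TopologicalSpace P'] [ChartedSpace E' P']
  {E : Type*} [NormedAddCommGroup E] [NormedSpace ℝ E]
  {P : Type*} [TopologicalSpace P] [ChartedSpace E P]
  {EM : Type*} [NormedAddCommGroup EM] [NormedSpace ℝ EM]
  {M : Type*} [TopologicalSpace M] [ChartedSpace EM M]

variable (E EM) in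
/-- A fibration: a surjective submersion. -/
structure IsFibration (π : P → M) : Prop where
  smooth : ContMDiff 𝓘(ℝ, E) 𝓘(ℝ, EM) ∞ π
  surjective : Function.Surjective π
  submersion : ∀ p, Function.Surjective (mfderiv 𝓘(ℝ, E) 𝓘(ℝ, EM) π p)

variable (E EM) in
/-- The vertical bundle `T^π P = ker dπ`. -/
def vertical (π : P → M) (p : P) : Submodule ℝ (TangentSpace 𝓘(ℝ, E) p) :=
  LinearMap.ker (mfderiv 𝓘(ℝ, E) 𝓘(ℝ, EM) π p).toLinearMap

variable (EM) in
/-- The symbol space `g(H) = T^π P ∩ H`. -/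
def symbolSpace (π : P → M) (H : ∀ p : P, Submodule ℝ (TangentSpace 𝓘(ℝ, E) p)) (p : P) :
    Submodule ℝ (TangentSpace 𝓘(ℝ, E) p) :=
  vertical E EM π p ⊓ H p

/-- Frobenius involutivity: the Lie bracket of two (local) vector fields tangent to `D` is tangent
to `D`. -/
def IsInvolutive [IsManifold 𝓘(ℝ, E) ∞ P] (D : ∀ p : P, Submodule ℝ (TangentSpace 𝓘(ℝ, E) p)) : Prop :=
  ∀ (U : Set P) (X Y : ∀ p : P, TangentSpace 𝓘(ℝ, E) p), IsOpen U →
    ContMDiffOn 𝓘(ℝ, E) 𝓘(ℝ, E).tangent ∞ (fun p => (⟨p, X p⟩ : TangentBundle 𝓘(ℝ, E) P)) U →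
    ContMDiffOn 𝓘(ℝ, E) 𝓘(ℝ, E).tangent ∞ (fun p => (⟨p, Y p⟩ : TangentBundle 𝓘(ℝ, E) P)) U →
    (∀ p ∈ U, X p ∈ D p) → (∀ p ∈ U, Y p ∈ D p) →
    ∀ p ∈ U, VectorField.mlieBracket 𝓘(ℝ, E) X Y p ∈ D p

variable (EM) in
/-- `(P, H)` is a Pfaffian fibration over `M`: `π : P → M` is a fibration and `H` is a smooth
distribution on `P`, transversal to the fibres of `π`, with involutive symbol space. -/
structure IsPfaffianFibration [IsManifold 𝓘(ℝ, E) ∞ P] (π : P → M)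
    (H : ∀ p : P, Submodule ℝ (TangentSpace 𝓘(ℝ, E) p)) : Prop where
  isFibration : IsFibration E EM π
  isDistribution : IsVectorSubbundle E E H
  transversal : ∀ p, vertical E EM π p ⊔ H p = ⊤
  involutive : IsInvolutive (symbolSpace EM π H)

/-- `φ : (P', H') → (P, H)` is a Pfaffian morphism over `M`: a surjective submersion commuting with
the projections `π'`, `π` to `M` such that `dφ(H') ⊆ H`. -/
structure IsPfaffianMorphism (π' : P' → M) (H' : ∀ p : P', Submodule ℝ (TangentSpace 𝓘(ℝ, E') p))
    (π : P → M) (H : ∀ p : P, Submodule ℝ (TangentSpace 𝓘(ℝ, E) p)) (φ : P' → P) : Prop where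
  isFibration : IsFibration E' E φ
  comp_eq : π ∘ φ = π'
  map_mem : ∀ p, ∀ v ∈ H' p, mfderiv 𝓘(ℝ, E') 𝓘(ℝ, E) φ p v ∈ H (φ p)

end Fibrations

section Jets

variable {EM : Type*} [NormedAddCommGroup EM] [NormedSpace ℝ EM]
  {M : Type*} [TopologicalSpace M] [ChartedSpace EM M] [IsManifold 𝓘(ℝ, EM) ∞ M]
  {EP : Type*} [NormedAddCommGroup EP] [NormedSpace ℝ EP]
  {P : Type*} [TopologicalSpace P] [ChartedSpace EP P] [IsManifold 𝓘(ℝ, EP) ∞ P]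
  {EQ : Type*} [NormedAddCommGroup EQ] [NormedSpace ℝ EQ]
  {Q : Type*} [TopologicalSpace Q] [ChartedSpace EQ Q]

/-- The fibres `T_{π(p)} M` of the pullback `π^* TM` of the tangent bundle of `M`. -/
abbrev PullbackTangent (π : C^∞⟮𝓘(ℝ, EP), P; 𝓘(ℝ, EM), M⟯) (p : P) : Type _ :=
  TangentSpace 𝓘(ℝ, EM) (π p)

instance (π : C^∞⟮𝓘(ℝ, EP), P; 𝓘(ℝ, EM), M⟯) :
    TopologicalSpace (Bundle.TotalSpace EM (PullbackTangent π)) :=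
  inferInstanceAs (TopologicalSpace
    (Bundle.TotalSpace EM (Bundle.Pullback π (TangentSpace 𝓘(ℝ, EM)))))

instance (π : C^∞⟮𝓘(ℝ, EP), P; 𝓘(ℝ, EM), M⟯) : FiberBundle EM (PullbackTangent π) :=
  inferInstanceAs (FiberBundle EM (Bundle.Pullback π (TangentSpace 𝓘(ℝ, EM))))

instance (π : C^∞⟮𝓘(ℝ, EP), P; 𝓘(ℝ, EM), M⟯) : VectorBundle ℝ EM (PullbackTangent π) :=
  inferInstanceAs (VectorBundle ℝ EM (Bundle.Pullback π (TangentSpace 𝓘(ℝ, EM))))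

instance (π : C^∞⟮𝓘(ℝ, EP), P; 𝓘(ℝ, EM), M⟯) :
    ContMDiffVectorBundle ∞ EM (PullbackTangent π) 𝓘(ℝ, EP) :=
  inferInstanceAs
    (ContMDiffVectorBundle ∞ EM (Bundle.Pullback π (TangentSpace 𝓘(ℝ, EM))) 𝓘(ℝ, EP))

/-- The fibres `Hom(T_{π(p)} M, T_p P)` of the vector bundle `Hom(π^* TM, TP)` over `P`. -/
abbrev HomFiber (π : C^∞⟮𝓘(ℝ, EP), P; 𝓘(ℝ, EM), M⟯) (p : P) : Type _ :=
  PullbackTangent π p →L[ℝ] TangentSpace 𝓘(ℝ, EP) p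

/-- The total space of the vector bundle `Hom(π^* TM, TP)` over `P`, a smooth manifold; its points
are the pairs `(p, ζ)` with `ζ : T_{π(p)} M → T_p P` linear. -/
abbrev HomBundle (π : C^∞⟮𝓘(ℝ, EP), P; 𝓘(ℝ, EM), M⟯) : Type _ :=
  Bundle.TotalSpace (EM →L[ℝ] EP) (HomFiber π)

/-- The first jet bundle `J¹P`: the pairs `(p, ζ)` with `ζ : T_{π(p)} M → T_p P` linear and
`dπ ∘ ζ = id`. It is a submanifold (an affine subbundle) of the vector bundle `Hom(π^* TM, TP)`. -/
def jetBundle (π : C^∞⟮𝓘(ℝ, EP), P; 𝓘(ℝ, EM), M⟯) : Set (HomBundle π) :=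
  {ξ | ∀ v : TangentSpace 𝓘(ℝ, EM) (π ξ.proj),
    mfderiv 𝓘(ℝ, EP) 𝓘(ℝ, EM) π ξ.proj (ξ.snd v) = v}

/-- The partial prolongation `J¹_H P`: the jets `(p, ζ)` such that `ζ` takes values in `H p`, i.e.
whose image is a partial integral element of `(P, H)`. -/
def partialProlongation (π : C^∞⟮𝓘(ℝ, EP), P; 𝓘(ℝ, EM), M⟯)
    (H : ∀ p : P, Submodule ℝ (TangentSpace 𝓘(ℝ, EP) p)) : Set (HomBundle π) :=
  {ξ ∈ jetBundle π | ∀ v, ξ.snd v ∈ H ξ.proj}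

/-- The family of subspaces `Hom(T_{π(p)} M, S p)` of the fibres of `Hom(π^* TM, TP)`. -/
def homInto (π : C^∞⟮𝓘(ℝ, EP), P; 𝓘(ℝ, EM), M⟯)
    (S : ∀ p : P, Submodule ℝ (TangentSpace 𝓘(ℝ, EP) p)) (p : P) : Submodule ℝ (HomFiber π p) where
  carrier := {ζ | ∀ v, ζ v ∈ S p}
  add_mem' ha hb v := (S p).add_mem (ha v) (hb v)
  zero_mem' _ := (S p).zero_mem
  smul_mem' c _ ha v := (S p).smul_mem c (ha v)

/-- The differential of `pr : Hom(π^* TM, TP) → P`, `(p, ζ) ↦ p`. -/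
def prDeriv (π : C^∞⟮𝓘(ℝ, EP), P; 𝓘(ℝ, EM), M⟯) (ξ : HomBundle π) :
    TangentSpace (𝓘(ℝ, EP).prod 𝓘(ℝ, EM →L[ℝ] EP)) ξ →L[ℝ] TangentSpace 𝓘(ℝ, EP) ξ.proj :=
  mfderiv (𝓘(ℝ, EP).prod 𝓘(ℝ, EM →L[ℝ] EP)) 𝓘(ℝ, EP) (fun η : HomBundle π => η.proj) ξ

/-- The Cartan form `θ_ξ(X) = d pr(X) - ζ(d(π ∘ pr)(X))` at `ξ = (p, ζ)`. (For `ξ` in `J¹P` and `X`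
tangent to `J¹P` it takes values in `T^π P`.) -/
def cartanForm (π : C^∞⟮𝓘(ℝ, EP), P; 𝓘(ℝ, EM), M⟯) (ξ : HomBundle π) :
    TangentSpace (𝓘(ℝ, EP).prod 𝓘(ℝ, EM →L[ℝ] EP)) ξ →L[ℝ] TangentSpace 𝓘(ℝ, EP) ξ.proj :=
  prDeriv π ξ - ξ.snd.comp ((mfderiv 𝓘(ℝ, EP) 𝓘(ℝ, EM) π ξ.proj).comp (prDeriv π ξ))

variable (EQ) in
/-- The restriction of the Cartan distribution to a manifold `Q` mapped to `Hom(π^* TM, TP)` by `f`: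
the vectors `v` with `θ(df(v)) = 0`. If `f` is the inclusion of a submanifold `Q` of `J¹P`, this
is `C ∩ TQ` with `C ⊆ TJ¹P` the kernel of the Cartan form. -/
def cartanDistribution (π : C^∞⟮𝓘(ℝ, EP), P; 𝓘(ℝ, EM), M⟯) (f : Q → HomBundle π) (x : Q) :
    Submodule ℝ (TangentSpace 𝓘(ℝ, EQ) x) :=
  LinearMap.ker ((cartanForm π (f x)).comp
    (mfderiv 𝓘(ℝ, EQ) (𝓘(ℝ, EP).prod 𝓘(ℝ, EM →L[ℝ] EP)) f x)).toLinearMap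

end Jets

end Pfaffian

end

/-!
Write a jet as `(p, ζ)`. The conditions `dπ ∘ ζ = id` and `ζ(T_{π(p)} M) ⊆ H_p` say that
`(dπ, a) ∘ ζ = (id, 0)`, where `a` is a local smooth family of surjections `T_p P → W` with kernel
`H_p`. By transversality `(dπ, a) : T_p P → T_{π(p)} M × W` is onto, and a smooth family of
surjections becomes constant after precomposition with a smooth family of automorphisms
(`exists_straightening`); that `H_p` is such a kernel is `IsSmoothFrameOn.exists_ker`. So there are
local smooth fibrewise linear coordinates of `Hom(π^* TM, TP)` in which `J¹_H P` is the constant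
affine subspace `s₀ + G` and `Hom(π^* TM, g(H))` the constant linear subspace `G` (`IsAdapted`,
`exists_isAdapted`). This normal form yields the slice charts of `J¹_H P`
(`exists_isSmoothEmbedding_partialProlongation`) and its local trivializations as an affine bundle
(`isAffineBundle_partialProlongation`); the latter have local sections, so `pr` is a surjective
submersion.

A vector `X` at `(p, ζ)` is a Cartan vector if and only if `d pr(X) = ζ(dπ(d pr(X)))`
(`mem_cartanDistribution_iff`), and the remaining claims follow from this description.
* The Cartan form is `(1 - ζ ∘ dπ) ∘ d pr`; as `pr` is a submersion its range is `ker dπ`, so its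
  kernel has constant rank and is a vector subbundle (`isVectorSubbundle_cartanDistribution`).
* Lifting along `pr` the vectors `ζ(dπ(d pr(X)))` shows transversality.
* The symbol space is `ker d pr` (`symbolSpace_cartanDistribution`), which is involutive, as is the
  kernel of the differential of every smooth map (`isInvolutive_vertical`).
* `d pr` maps Cartan vectors at `(p, ζ)` into the range of `ζ`. Hence `d pr(C) ⊆ H` on `J¹_H P`, and
  if `pr` is a submersion on a submanifold of `J¹P`, every vector in the range of `ζ` arises in this
  way, so `d pr(C) ⊆ H` forces `ζ` to take values in `H`
  (`mem_partialProlongation_of_map_cartanDistribution`).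
-/

namespace Pfaffian

/-! ### Smooth families of linear maps -/

section Straightening

variable {EX : Type*} [NormedAddCommGroup EX] [NormedSpace ℝ EX]
  {HX : Type*} [TopologicalSpace HX] {I : ModelWithCorners ℝ EX HX}
  {X : Type*} [TopologicalSpace X] [ChartedSpace HX X]
  {F : Type*} [NormedAddCommGroup F] [NormedSpace ℝ F] [FiniteDimensional ℝ F]
  {W : Type*} [NormedAddCommGroup W] [NormedSpace ℝ W]

/-- A smooth family of endomorphisms which is the identity at a point is, near that point, a smooth
family of automorphisms with smooth inverse. -/
lemma exists_smooth_automorphisms {U : Set X} (hU : IsOpen U) {x₀ : X} (hx₀ : x₀ ∈ U)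
    {A : X → F →L[ℝ] F} (hA : ContMDiffOn I 𝓘(ℝ, F →L[ℝ] F) ∞ A U)
    (h₀ : A x₀ = ContinuousLinearMap.id ℝ F) :
    ∃ (U' : Set X) (T : X → F ≃L[ℝ] F), IsOpen U' ∧ x₀ ∈ U' ∧ U' ⊆ U ∧
      (∀ x ∈ U', (T x : F →L[ℝ] F) = A x) ∧
      ContMDiffOn I 𝓘(ℝ, F →L[ℝ] F) ∞ (fun x => (T x : F →L[ℝ] F)) U' ∧
      ContMDiffOn I 𝓘(ℝ, F →L[ℝ] F) ∞ (fun x => ((T x).symm : F →L[ℝ] F)) U' := by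
  classical
  have : CompleteSpace F := FiniteDimensional.complete ℝ F
  let U' := U ∩ A ⁻¹' {a | IsUnit a}
  have hT : ∀ x, ∃ T : F ≃L[ℝ] F, IsUnit (A x) →
      (T : F →L[ℝ] F) = A x ∧ (T.symm : F →L[ℝ] F) = Ring.inverse (A x) := by
    intro x
    by_cases h : IsUnit (A x)
    · obtain ⟨u, hu⟩ := h
      refine ⟨ContinuousLinearEquiv.unitsEquiv ℝ F u, fun _ => ⟨by rw [← hu]; rfl, ?_⟩⟩
      rw [← hu, Ring.inverse_unit]
      rfl
    · exact ⟨.refl ℝ F, fun h' => (h h').elim⟩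
  choose T hT using hT
  refine ⟨U', T, hA.continuousOn.isOpen_inter_preimage hU Units.isOpen, ⟨hx₀, ?_⟩,
    Set.inter_subset_left, fun x hx => (hT x hx.2).1, ?_, ?_⟩
  · change IsUnit (A x₀)
    rw [h₀]
    exact isUnit_one
  · exact (hA.mono Set.inter_subset_left).congr fun x hx => (hT x hx.2).1
  · refine ContMDiffOn.congr (f := fun x => Ring.inverse (A x)) (fun x hx => ?_)
      fun x hx => (hT x hx.2).2
    obtain ⟨u, hu⟩ := hx.2
    have h1 : ContDiffAt ℝ ∞ (Ring.inverse : (F →L[ℝ] F) → F →L[ℝ] F) (A x) := by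
      rw [← hu]
      exact contDiffAt_ringInverse ℝ u
    exact h1.comp_contMDiffWithinAt ((hA x hx.1).mono Set.inter_subset_left)

/-- A smooth family of linear maps, surjective at one point, becomes constant near that point after
precomposition with a smooth family of automorphisms. -/
lemma exists_straightening [FiniteDimensional ℝ W] {U : Set X} (hU : IsOpen U) {x₀ : X}
    (hx₀ : x₀ ∈ U) {A : X → F →L[ℝ] W} (hA : ContMDiffOn I 𝓘(ℝ, F →L[ℝ] W) ∞ A U)
    (h₀ : Function.Surjective (A x₀)) :
    ∃ (U' : Set X) (T : X → F ≃L[ℝ] F), IsOpen U' ∧ x₀ ∈ U' ∧ U' ⊆ U ∧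
      (∀ x ∈ U', ∀ v, A x v = A x₀ (T x v)) ∧
      ContMDiffOn I 𝓘(ℝ, F →L[ℝ] F) ∞ (fun x => (T x : F →L[ℝ] F)) U' ∧
      ContMDiffOn I 𝓘(ℝ, F →L[ℝ] F) ∞ (fun x => ((T x).symm : F →L[ℝ] F)) U' := by
  obtain ⟨R, hR⟩ := LinearMap.exists_rightInverse_of_surjective (A x₀).toLinearMap
    (LinearMap.range_eq_top.2 h₀)
  have hR' : ∀ w, A x₀ (R w) = w := fun w => congrArg (fun f => f w) hR
  let R' : W →L[ℝ] F := LinearMap.toContinuousLinearMap R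
  -- With `R` a right inverse of `A x₀`, the map `1 + R (A x - A x₀)` carries `A x` to `A x₀`.
  let B : X → F →L[ℝ] F := fun x => ContinuousLinearMap.id ℝ F + R'.comp (A x - A x₀)
  have hB : ContMDiffOn I 𝓘(ℝ, F →L[ℝ] F) ∞ B U :=
    contMDiffOn_const.add (contMDiffOn_const.clm_comp (hA.sub contMDiffOn_const))
  obtain ⟨U', T, h1, h2, h3, h4, h5, h6⟩ := exists_smooth_automorphisms hU hx₀ hB (by simp [B])
  refine ⟨U', T, h1, h2, h3, fun x hx v => ?_, h5, h6⟩
  have : T x v = B x v := congrArg (fun f => f v) (h4 x hx)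
  rw [this]
  simp [B, R', hR']

/-- A smooth family of linear maps of constant rank has, locally, a smoothly trivializable
kernel. -/
lemma exists_straightening_ker [FiniteDimensional ℝ W] {U : Set X} (hU : IsOpen U) {x₀ : X}
    (hx₀ : x₀ ∈ U) {A : X → F →L[ℝ] W} (hA : ContMDiffOn I 𝓘(ℝ, F →L[ℝ] W) ∞ A U) {k : ℕ}
    (hk : ∀ x ∈ U, Module.finrank ℝ (LinearMap.ker (A x).toLinearMap) = k) :
    ∃ (U' : Set X) (T : X → F ≃L[ℝ] F), IsOpen U' ∧ x₀ ∈ U' ∧ U' ⊆ U ∧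
      (∀ x ∈ U', ∀ v, A x v = 0 ↔ A x₀ (T x v) = 0) ∧
      ContMDiffOn I 𝓘(ℝ, F →L[ℝ] F) ∞ (fun x => (T x : F →L[ℝ] F)) U' ∧
      ContMDiffOn I 𝓘(ℝ, F →L[ℝ] F) ∞ (fun x => ((T x).symm : F →L[ℝ] F)) U' := by
  -- Composing with a projection to the range of `A x₀` makes `A x₀` surjective. It does not change
  -- the kernels near `x₀`: they can only grow, and their dimensions stay equal to `k`.
  let V := LinearMap.range (A x₀).toLinearMap
  obtain ⟨q, hq⟩ := V.subtype.exists_leftInverse_of_injective V.ker_subtype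
  have hq' : ∀ w : V, q w = w := fun w => congrArg (fun f => f w) hq
  let q' : W →L[ℝ] V := LinearMap.toContinuousLinearMap q
  have hqA : ∀ v, (q (A x₀ v) : W) = A x₀ v := fun v =>
    congrArg Subtype.val (hq' ⟨A x₀ v, v, rfl⟩)
  have hB : ContMDiffOn I 𝓘(ℝ, F →L[ℝ] V) ∞ (fun x => q'.comp (A x)) U :=
    contMDiffOn_const.clm_comp hA
  obtain ⟨U', T, h1, h2, h3, h4, h5, h6⟩ := exists_straightening hU hx₀ hB (by
    rintro ⟨w, v, rfl⟩
    exact ⟨v, hq' ⟨A x₀ v, v, rfl⟩⟩)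
  refine ⟨U', T, h1, h2, h3, fun x hx v => ?_, h5, h6⟩
  have h4' : ∀ v, q (A x v) = q (A x₀ (T x v)) := h4 x hx
  have key : ∀ v, q (A x v) = 0 ↔ A x₀ (T x v) = 0 := fun v => by
    rw [h4' v, ← Subtype.coe_inj, hqA]
    rfl
  rw [← key]
  have hle : LinearMap.ker (A x).toLinearMap ≤ LinearMap.ker (q ∘ₗ (A x).toLinearMap) := by
    intro v hv
    have hv' : A x v = 0 := hv
    change q (A x v) = 0
    rw [hv', map_zero]
  have hfin : Module.finrank ℝ (LinearMap.ker (q ∘ₗ (A x).toLinearMap)) =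
      Module.finrank ℝ (LinearMap.ker (A x₀).toLinearMap) := by
    have : LinearMap.ker (q ∘ₗ (A x).toLinearMap) =
        (LinearMap.ker (A x₀).toLinearMap).comap (T x).toLinearEquiv.toLinearMap := by
      ext v
      exact key v
    rw [this]
    exact LinearEquiv.finrank_eq
      ((T x).toLinearEquiv.submoduleMap _ |>.trans (LinearEquiv.ofEq _ _ (by
        rw [Submodule.map_comap_eq_of_surjective (T x).toLinearEquiv.surjective])))
  have heq := Submodule.eq_of_le_of_finrank_eq hle
    (by rw [hk x (h3 hx), hfin, hk x₀ hx₀])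
  have := SetLike.ext_iff.1 heq v
  exact this

end Straightening

/-! ### Kernels of smooth families as vector subbundles -/

section Subbundle

variable {EB : Type*} [NormedAddCommGroup EB] [NormedSpace ℝ EB]
  {B : Type*} [TopologicalSpace B] [ChartedSpace EB B]
  {F : Type*} [NormedAddCommGroup F] [NormedSpace ℝ F]
  {V : B → Type*} [TopologicalSpace (Bundle.TotalSpace F V)]
  [∀ b, TopologicalSpace (V b)] [∀ b, AddCommGroup (V b)] [∀ b, Module ℝ (V b)]
  [FiberBundle F V] [VectorBundle ℝ F V] [ContMDiffVectorBundle ∞ F V 𝓘(ℝ, EB)]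
  {W : Type*} [NormedAddCommGroup W] [NormedSpace ℝ W] [FiniteDimensional ℝ W]

/-- In a trivialization `e`, linearly independent vectors moved by a smooth family of automorphisms
form a smooth frame. -/
lemma isSmoothFrameOn_symm (e : Bundle.Trivialization F (Bundle.TotalSpace.proj (E := V)))
    [MemTrivializationAtlas e] {U : Set B} (hU : IsOpen U) (hUe : U ⊆ e.baseSet)
    {T : B → F ≃L[ℝ] F}
    (hT : ContMDiffOn 𝓘(ℝ, EB) 𝓘(ℝ, F →L[ℝ] F) ∞ (fun b => ((T b).symm : F →L[ℝ] F)) U)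
    {k : ℕ} {S₀ : Submodule ℝ F} (c : Module.Basis (Fin k) ℝ S₀)
    {S : ∀ b, Submodule ℝ (V b)}
    (hS : ∀ b ∈ U, ∀ v : V b, v ∈ S b ↔ T b (e.continuousLinearMapAt ℝ b v) ∈ S₀) :
    IsSmoothFrameOn EB F S U (fun i b => e.symmL ℝ b ((T b).symm (c i : F))) := by
  have hi : LinearIndependent ℝ (fun i => (c i : F)) :=
    c.linearIndependent.map' S₀.subtype S₀.ker_subtype
  have hs : Submodule.span ℝ (Set.range fun i => (c i : F)) = S₀ := by
    have : (Set.range fun i => (c i : F)) = S₀.subtype '' Set.range c := by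
      rw [← Set.range_comp]; rfl
    rw [this, Submodule.span_image, c.span_eq, Submodule.map_top, Submodule.range_subtype]
  refine ⟨fun i => ?_, fun b hb => ?_, fun b hb => ?_⟩
  · refine (e.contMDiffOn_section_iff hU hUe).2 ?_
    refine (hT.clm_apply (contMDiffOn_const (c := (c i : F)))).congr fun b hb => ?_
    have := e.continuousLinearMapAt_symmL (R := ℝ) (hUe hb) ((T b).symm (c i : F))
    rwa [e.continuousLinearMapAt_apply (R := ℝ), e.coe_linearMapAt_of_mem (hUe hb)] at this
  · refine LinearIndependent.of_comp
      ((T b).toLinearMap ∘ₗ (e.continuousLinearMapAt ℝ b).toLinearMap) ?_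
    convert hi using 1
    ext i
    change T b (e.continuousLinearMapAt ℝ b (e.symmL ℝ b ((T b).symm (c i : F)))) = c i
    rw [e.continuousLinearMapAt_symmL (hUe hb), ContinuousLinearEquiv.apply_symm_apply]
  · apply le_antisymm
    · rw [Submodule.span_le]
      rintro _ ⟨i, rfl⟩
      rw [SetLike.mem_coe, hS b hb, e.continuousLinearMapAt_symmL (hUe hb),
        ContinuousLinearEquiv.apply_symm_apply]
      exact (c i).2
    · intro v hv
      rw [hS b hb, ← hs] at hv
      have h := Submodule.mem_map_of_mem
        (f := (e.symmL ℝ b).toLinearMap ∘ₗ (T b).symm.toLinearMap) hv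
      rw [Submodule.map_span, ← Set.range_comp] at h
      convert h using 1
      · rfl
      · change v = e.symmL ℝ b ((T b).symm (T b (e.continuousLinearMapAt ℝ b v)))
        rw [ContinuousLinearEquiv.symm_apply_apply, e.symmL_continuousLinearMapAt (hUe hb)]

/-- A family of subspaces of constant dimension `k` which, near `b₀`, is the kernel of a smooth
family of linear maps in a trivialization has a smooth frame near `b₀`. -/
lemma exists_isSmoothFrameOn_of_ker [FiniteDimensional ℝ F]
    (e : Bundle.Trivialization F (Bundle.TotalSpace.proj (E := V)))
    [MemTrivializationAtlas e] {S : ∀ b, Submodule ℝ (V b)} {k : ℕ} {U : Set B} (hU : IsOpen U)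
    (hUe : U ⊆ e.baseSet) {b₀ : B} (hb₀ : b₀ ∈ U)
    {A : B → F →L[ℝ] W} (hA : ContMDiffOn 𝓘(ℝ, EB) 𝓘(ℝ, F →L[ℝ] W) ∞ A U)
    (hS : ∀ b ∈ U, ∀ v : V b, v ∈ S b ↔ A b (e.continuousLinearMapAt ℝ b v) = 0)
    (hk : ∀ b ∈ U, Module.finrank ℝ (S b) = k) :
    ∃ U' : Set B, IsOpen U' ∧ b₀ ∈ U' ∧
      ∃ s : Fin k → ∀ b, V b, IsSmoothFrameOn EB F S U' s := by
  have hk' : ∀ b ∈ U, Module.finrank ℝ (LinearMap.ker (A b).toLinearMap) = k := by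
    intro b hb
    rw [← hk b hb]
    have : S b = (LinearMap.ker (A b).toLinearMap).comap
        (e.continuousLinearEquivAt ℝ b (hUe hb)).toLinearEquiv.toLinearMap := by
      ext v
      rw [hS b hb, Submodule.mem_comap, LinearMap.mem_ker]
      rw [← e.coe_continuousLinearEquivAt_eq (hUe hb)]
      rfl
    rw [this]
    exact (LinearEquiv.finrank_eq
      ((e.continuousLinearEquivAt ℝ b (hUe hb)).toLinearEquiv.submoduleMap _ |>.trans
      (LinearEquiv.ofEq _ _ (by
        rw [Submodule.map_comap_eq_of_surjective (LinearEquiv.surjective _)])))).symm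
  obtain ⟨U', T, h1, h2, h3, h4, h5, h6⟩ := exists_straightening_ker hU hb₀ hA hk'
  refine ⟨U', h1, h2, _, isSmoothFrameOn_symm e h1 (h3.trans hUe) h6
    (Module.finBasisOfFinrankEq ℝ _ (hk' b₀ hb₀)) fun b hb v => ?_⟩
  rw [hS b (h3 hb), h4 b hb]
  rfl

/-- Near every point, a vector subbundle is, in a trivialization, the kernel of a smooth family of
surjective linear maps. -/
lemma IsSmoothFrameOn.exists_ker [FiniteDimensional ℝ F]
    (e : Bundle.Trivialization F (Bundle.TotalSpace.proj (E := V)))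
    [MemTrivializationAtlas e] {S : ∀ b, Submodule ℝ (V b)} {k : ℕ} {U : Set B} (hU : IsOpen U)
    (hUe : U ⊆ e.baseSet) {b₀ : B} (hb₀ : b₀ ∈ U) {s : Fin k → ∀ b, V b}
    (hs : IsSmoothFrameOn EB F S U s) :
    ∃ (U' : Set B) (W : Submodule ℝ F) (A : B → F →L[ℝ] W), IsOpen U' ∧ b₀ ∈ U' ∧ U' ⊆ U ∧
      Module.finrank ℝ W + k = Module.finrank ℝ F ∧
      ContMDiffOn 𝓘(ℝ, EB) 𝓘(ℝ, F →L[ℝ] W) ∞ A U' ∧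
      (∀ b ∈ U', Function.Surjective (A b)) ∧
      ∀ b ∈ U', ∀ v : V b, v ∈ S b ↔ A b (e.continuousLinearMapAt ℝ b v) = 0 := by
  -- the frame in the trivialization, as a family of injective maps `ℝᵏ → F`
  let a : B → (Fin k → ℝ) →L[ℝ] F := fun b => ∑ i,
    (ContinuousLinearMap.proj (R := ℝ) (φ := fun _ : Fin k => ℝ) i).smulRight
      (e.continuousLinearMapAt ℝ b (s i b))
  have ha : ContMDiffOn 𝓘(ℝ, EB) 𝓘(ℝ, (Fin k → ℝ) →L[ℝ] F) ∞ a U := by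
    refine contMDiffOn_finsetSum fun i _ => ?_
    have h1 := (e.contMDiffOn_section_iff hU hUe).1 (hs.smooth i)
    have h2 : ContMDiffOn 𝓘(ℝ, EB) 𝓘(ℝ, F) ∞ (fun b => e.continuousLinearMapAt ℝ b (s i b)) U := by
      refine h1.congr fun b hb => ?_
      rw [e.continuousLinearMapAt_apply (R := ℝ), e.coe_linearMapAt_of_mem (hUe hb)]
    exact (ContinuousLinearMap.smulRightL ℝ (Fin k → ℝ) F
      (ContinuousLinearMap.proj (R := ℝ) (φ := fun _ : Fin k => ℝ) i)).contMDiff.comp_contMDiffOn h2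
  have ha_apply : ∀ b c, a b c = e.continuousLinearMapAt ℝ b (∑ i, c i • s i b) := by
    intro b c
    simp only [a, map_sum, map_smul]
    simp
  have ha_mem : ∀ b ∈ U, ∀ v : V b, v ∈ S b ↔
      e.continuousLinearMapAt ℝ b v ∈ LinearMap.range (a b).toLinearMap := by
    intro b hb v
    rw [← hs.span_eq b hb, Submodule.mem_span_range_iff_exists_fun, LinearMap.mem_range]
    refine exists_congr fun c => ?_
    change _ ↔ a b c = _
    rw [ha_apply]
    rw [← e.coe_continuousLinearEquivAt_eq (hUe hb)]
    exact (e.continuousLinearEquivAt ℝ b (hUe hb)).injective.eq_iff.symm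
  have hinj : LinearMap.ker (a b₀).toLinearMap = ⊥ := by
    rw [LinearMap.ker_eq_bot']
    intro c hc
    have hc' : a b₀ c = 0 := hc
    rw [ha_apply, ← e.coe_continuousLinearEquivAt_eq (hUe hb₀)] at hc'
    have h0 : ∑ i, c i • s i b₀ = 0 :=
      (e.continuousLinearEquivAt ℝ b₀ (hUe hb₀)).map_eq_zero_iff.1 hc'
    exact funext (Fintype.linearIndependent_iff.1 (hs.linearIndependent b₀ hb₀) c h0)
  obtain ⟨p, hp⟩ := (a b₀).toLinearMap.exists_leftInverse_of_injective hinj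
  have hp' : ∀ c, p (a b₀ c) = c := fun c => congrArg (fun f => f c) hp
  let p' : F →L[ℝ] (Fin k → ℝ) := LinearMap.toContinuousLinearMap p
  -- `T b = 1 + (a b - a b₀) p` carries the range of `a b₀` to the range of `a b`
  obtain ⟨U', T, h1, h2, h3, h4, h5, h6⟩ := exists_smooth_automorphisms hU hb₀
    (A := fun b => ContinuousLinearMap.id ℝ F + (a b - a b₀).comp p')
    (contMDiffOn_const.add ((ha.sub contMDiffOn_const).clm_comp contMDiffOn_const)) (by simp)
  have hTa : ∀ b ∈ U', ∀ c, T b (a b₀ c) = a b c := by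
    intro b hb c
    have : T b (a b₀ c) = _ := congrArg (fun f => f (a b₀ c)) (h4 b hb)
    rw [this]
    simp [p', hp']
  let Q : F →L[ℝ] F := ContinuousLinearMap.id ℝ F - (a b₀).comp p'
  have hQ : ∀ v, Q v = v - a b₀ (p v) := fun v => rfl
  have hQker : ∀ v, Q v ∈ LinearMap.ker p := fun v => by
    rw [LinearMap.mem_ker, hQ, map_sub, hp', sub_self]
  let Q' : F →L[ℝ] LinearMap.ker p := Q.codRestrict _ hQker
  refine ⟨U', LinearMap.ker p, fun b => Q'.comp ((T b).symm : F →L[ℝ] F), h1, h2, h3, ?_,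
    contMDiffOn_const.clm_comp h6, ?_, ?_⟩
  · have hsurj : LinearMap.range p = ⊤ :=
      LinearMap.range_eq_top.2 fun c => ⟨_, hp' c⟩
    have := p.finrank_range_add_finrank_ker
    rw [hsurj, finrank_top, Module.finrank_fin_fun] at this
    omega
  · rintro b hb ⟨w, hw⟩
    refine ⟨T b w, Subtype.ext ?_⟩
    change Q ((T b).symm (T b w)) = w
    rw [ContinuousLinearEquiv.symm_apply_apply, hQ, LinearMap.mem_ker.1 hw, map_zero, sub_zero]
  · intro b hb v
    rw [ha_mem b (h3 hb), ← Subtype.coe_inj]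
    change _ ↔ Q ((T b).symm _) = 0
    rw [hQ, sub_eq_zero]
    constructor
    · rintro ⟨c, hc⟩
      have hc' : a b c = _ := hc
      rw [← hc', ← hTa b hb, ContinuousLinearEquiv.symm_apply_apply, hp']
    · intro h
      refine ⟨p ((T b).symm (e.continuousLinearMapAt ℝ b v)), ?_⟩
      change a b _ = _
      rw [← hTa b hb, ← h, ContinuousLinearEquiv.apply_symm_apply]

end Subbundle

/-! ### Differentials in trivializations -/

section TangentCoordinates

variable {E : Type*} [NormedAddCommGroup E] [NormedSpace ℝ E]
  {X : Type*} [TopologicalSpace X] [ChartedSpace E X] [IsManifold 𝓘(ℝ, E) ∞ X]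
  {E' : Type*} [NormedAddCommGroup E'] [NormedSpace ℝ E']
  {Y : Type*} [TopologicalSpace Y] [ChartedSpace E' Y] [IsManifold 𝓘(ℝ, E') ∞ Y]

/-- The differential of a smooth map is smooth when read in trivializations of the tangent
bundles. -/
lemma contMDiffOn_mfderiv_trivialization {f : X → Y} (hf : ContMDiff 𝓘(ℝ, E) 𝓘(ℝ, E') ∞ f)
    (e : Bundle.Trivialization E
      (Bundle.TotalSpace.proj (E := (TangentSpace 𝓘(ℝ, E) : X → Type _))))
    [MemTrivializationAtlas e]
    (e' : Bundle.Trivialization E'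
      (Bundle.TotalSpace.proj (E := (TangentSpace 𝓘(ℝ, E') : Y → Type _))))
    [MemTrivializationAtlas e'] :
    ContMDiffOn 𝓘(ℝ, E) 𝓘(ℝ, E →L[ℝ] E') ∞
      (fun x => (e'.continuousLinearMapAt ℝ (f x)).comp
        ((mfderiv 𝓘(ℝ, E) 𝓘(ℝ, E') f x).comp (e.symmL ℝ x)))
      (e.baseSet ∩ f ⁻¹' e'.baseSet) := by
  intro x₁ hx₁
  let e₁ := trivializationAt E (TangentSpace 𝓘(ℝ, E) : X → Type _) x₁
  let e₁' := trivializationAt E' (TangentSpace 𝓘(ℝ, E') : Y → Type _) (f x₁)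
  have hb₁ : x₁ ∈ e₁.baseSet := FiberBundle.mem_baseSet_trivializationAt' x₁
  have hb₁' : f x₁ ∈ e₁'.baseSet := FiberBundle.mem_baseSet_trivializationAt' (f x₁)
  have h1 := (hf.contMDiffAt (x := x₁)).mfderiv_const (m := ∞) (by simp)
  have h2 : ContMDiffAt 𝓘(ℝ, E) 𝓘(ℝ, E →L[ℝ] E) ∞
      (fun x => (e.coordChangeL ℝ e₁ x : E →L[ℝ] E)) x₁ :=
    contMDiffAt_coordChangeL hx₁.1 hb₁
  have h3 : ContMDiffAt 𝓘(ℝ, E) 𝓘(ℝ, E' →L[ℝ] E') ∞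
      (fun x => (e₁'.coordChangeL ℝ e' (f x) : E' →L[ℝ] E')) x₁ :=
    (contMDiffAt_coordChangeL (IB := 𝓘(ℝ, E')) hb₁' hx₁.2).comp x₁ hf.contMDiffAt
  refine ((h3.clm_comp (h1.clm_comp h2)).congr_of_eventuallyEq ?_).contMDiffWithinAt
  have hopen : ∀ᶠ x in 𝓝 x₁,
      x ∈ e.baseSet ∧ x ∈ e₁.baseSet ∧ f x ∈ e'.baseSet ∧ f x ∈ e₁'.baseSet :=
    (e.open_baseSet.eventually_mem hx₁.1).and <| (e₁.open_baseSet.eventually_mem hb₁).and <|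
      Filter.Eventually.and
      (hf.continuous.continuousAt.preimage_mem_nhds (e'.open_baseSet.mem_nhds hx₁.2))
      (hf.continuous.continuousAt.preimage_mem_nhds (e₁'.open_baseSet.mem_nhds hb₁'))
  filter_upwards [hopen] with x hx
  obtain ⟨a1, a2, a3, a4⟩ := hx
  ext v
  have c1 : e.coordChangeL ℝ e₁ x v = e₁.continuousLinearMapAt ℝ x (e.symmL ℝ x v) := by
    rw [e.coordChangeL_apply e₁ ⟨a1, a2⟩, e₁.continuousLinearMapAt_apply (R := ℝ),
      e₁.coe_linearMapAt_of_mem a2, e.symmL_apply (R := ℝ) a1]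
  have c2 : ∀ w, e₁'.coordChangeL ℝ e' (f x) w =
      e'.continuousLinearMapAt ℝ (f x) (e₁'.symmL ℝ (f x) w) := by
    intro w
    rw [e₁'.coordChangeL_apply e' ⟨a4, a3⟩, e'.continuousLinearMapAt_apply (R := ℝ),
      e'.coe_linearMapAt_of_mem a3, e₁'.symmL_apply (R := ℝ) a4]
  change e'.continuousLinearMapAt ℝ (f x) (mfderiv 𝓘(ℝ, E) 𝓘(ℝ, E') f x (e.symmL ℝ x v)) =
    e₁'.coordChangeL ℝ e' (f x) (e₁'.continuousLinearMapAt ℝ (f x)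
      (mfderiv 𝓘(ℝ, E) 𝓘(ℝ, E') f x (e₁.symmL ℝ x (e.coordChangeL ℝ e₁ x v))))
  rw [c1, c2, e₁'.symmL_continuousLinearMapAt a4, e₁.symmL_continuousLinearMapAt a2]

end TangentCoordinates

/-! ### Submanifolds from slice charts -/

section Slice

variable {E : Type*} [NormedAddCommGroup E] [NormedSpace ℝ E]
  {H : Type*} [TopologicalSpace H] {I : ModelWithCorners ℝ E H} [I.Boundaryless]
  {X : Type*} [TopologicalSpace X]
  {E₀ : Type*} [NormedAddCommGroup E₀] [NormedSpace ℝ E₀]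
  {F : Type*} [NormedAddCommGroup F] [NormedSpace ℝ F]
  {S : Set X}

/-- The chart of a subset `S` induced by a slice chart: a chart `χ` of the ambient manifold in which
`S` is the linear subspace corresponding to `E₀ × 0` under `L : E₀ × F ≃ E`. The point `x` is a junk
value for the inverse. -/
noncomputable def sliceChart (χ : OpenPartialHomeomorph X H) (L : (E₀ × F) ≃L[ℝ] E) (x : S)
    (h : ∀ y ∈ χ.source, y ∈ S ↔ (L.symm (I (χ y))).2 = 0) : OpenPartialHomeomorph S E₀ := by
  classical
  have hI : ∀ z, I (I.symm z) = z := fun z => I.right_inv (by rw [I.range_eq_univ]; trivial)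
  have hinv : ∀ u : E₀, I.symm (L (u, 0)) ∈ χ.target → χ.symm (I.symm (L (u, 0))) ∈ S := by
    intro u hu
    rw [h _ (χ.map_target hu), χ.right_inv hu, hI]
    simp
  have hsymm : ∀ y : S, y.1 ∈ χ.source → L ((L.symm (I (χ y))).1, 0) = I (χ y) := by
    intro y hy
    rw [← (h y hy).1 y.2, Prod.mk.eta, ContinuousLinearEquiv.apply_symm_apply]
  exact
  { toFun := fun y => (L.symm (I (χ y))).1
    invFun := fun u => if hu : χ.symm (I.symm (L (u, 0))) ∈ S then ⟨_, hu⟩ else x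
    source := Subtype.val ⁻¹' χ.source
    target := {u | I.symm (L (u, 0)) ∈ χ.target}
    map_source' := fun y hy => by
      change I.symm (L _) ∈ χ.target
      rw [hsymm y hy, I.left_inv]
      exact χ.map_source hy
    map_target' := fun u hu => by
      simp only [dif_pos (hinv u hu)]
      exact χ.map_target hu
    left_inv' := fun y hy => by
      have h1 : χ.symm (I.symm (L ((L.symm (I (χ y))).1, 0))) = y.1 := by
        rw [hsymm y hy, I.left_inv, χ.left_inv hy]
      have h2 : χ.symm (I.symm (L ((L.symm (I (χ y))).1, 0))) ∈ S := by rw [h1]; exact y.2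
      rw [dif_pos h2]
      exact Subtype.ext h1
    right_inv' := fun u hu => by
      simp only [dif_pos (hinv u hu)]
      rw [χ.right_inv hu, hI]
      simp
    open_source := χ.open_source.preimage continuous_subtype_val
    open_target := by
      refine χ.open_target.preimage (I.continuous_symm.comp (L.continuous.comp ?_))
      fun_prop
    continuousOn_toFun := by
      refine (continuous_fst.comp (L.symm.continuous.comp I.continuous)).comp_continuousOn ?_
      exact χ.continuousOn.comp continuous_subtype_val.continuousOn fun y hy => hy
    continuousOn_invFun := by
      rw [Topology.IsEmbedding.subtypeVal.isInducing.continuousOn_iff]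
      refine ContinuousOn.congr (f := fun u : E₀ => χ.symm (I.symm (L (u, 0)))) ?_ fun u hu => ?_
      · refine χ.symm.continuousOn.comp (Continuous.continuousOn ?_) fun u hu => hu
        exact I.continuous_symm.comp (L.continuous.comp (by fun_prop))
      · simp only [Function.comp, dif_pos (hinv u hu)] }

lemma coe_sliceChart_symm (χ : OpenPartialHomeomorph X H) (L : (E₀ × F) ≃L[ℝ] E) (x : S)
    (h : ∀ y ∈ χ.source, y ∈ S ↔ (L.symm (I (χ y))).2 = 0) {u : E₀}
    (hu : I.symm (L (u, 0)) ∈ χ.target) :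
    ((sliceChart χ L x h).symm u : X) = χ.symm (I.symm (L (u, 0))) := by
  classical
  have hu' : χ.symm (I.symm (L (u, 0))) ∈ S := by
    rw [h _ (χ.map_target hu), χ.right_inv hu, I.right_inv (by rw [I.range_eq_univ]; trivial)]
    simp
  change ((if hu : χ.symm (I.symm (L (u, 0))) ∈ S then ⟨_, hu⟩ else x : S) : X) = _
  rw [dif_pos hu']

variable [FiniteDimensional ℝ E] [ChartedSpace H X]

/-- A subset which is, in suitable charts of the ambient manifold, a linear subspace of fixed
dimension `N` is an embedded submanifold. -/
theorem exists_isSmoothEmbedding_of_slices {N : ℕ}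
    (hS : ∀ x ∈ S, ∃ χ ∈ IsManifold.maximalAtlas I ∞ X, x ∈ χ.source ∧ ∃ K : Submodule ℝ E,
      Module.finrank ℝ K = N ∧ ∀ y ∈ χ.source, y ∈ S ↔ I (χ y) ∈ K) :
    ∃ (_ : ChartedSpace (EuclideanSpace ℝ (Fin N)) S) (_ : IsManifold (𝓡 N) ∞ S),
      Manifold.IsSmoothEmbedding (𝓡 N) I ∞ (Subtype.val : S → X) := by
  let E₀ := EuclideanSpace ℝ (Fin N)
  let F₀ := EuclideanSpace ℝ (Fin (Module.finrank ℝ E - N))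
  have key : ∀ x : S, ∃ χ ∈ IsManifold.maximalAtlas I ∞ X, x.1 ∈ χ.source ∧
      ∃ (L : (E₀ × F₀) ≃L[ℝ] E),
        ∀ y ∈ χ.source, y ∈ S ↔ (L.symm (I (χ y))).2 = 0 := by
    intro x
    obtain ⟨χ, hχ, hx, K, hK, h⟩ := hS x x.2
    obtain ⟨K', hK'⟩ := K.exists_isCompl
    let L₁ : E₀ ≃ₗ[ℝ] K := LinearEquiv.ofFinrankEq _ _ (by rw [hK]; simp [E₀])
    let L₂ : F₀ ≃ₗ[ℝ] K' := LinearEquiv.ofFinrankEq _ _ (by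
      have := Submodule.finrank_add_eq_of_isCompl hK'
      rw [finrank_euclideanSpace_fin]
      omega)
    let L : (E₀ × F₀) ≃ₗ[ℝ] E :=
      (L₁.prodCongr L₂).trans (Submodule.prodEquivOfIsCompl K K' hK')
    refine ⟨χ, hχ, hx, L.toContinuousLinearEquiv, fun y hy => ?_⟩
    rw [h y hy]
    change _ ↔ L₂.symm ((Submodule.prodEquivOfIsCompl K K' hK').symm (I (χ y))).2 = 0
    rw [LinearEquiv.map_eq_zero_iff, Submodule.prodEquivOfIsCompl_symm_apply_snd_eq_zero]
  choose χ hχ hx L hL using key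
  let c : ∀ x : S, OpenPartialHomeomorph S E₀ := fun x => sliceChart (χ x) (L x) x (hL x)
  let cs : ChartedSpace E₀ S :=
    { atlas := Set.range c
      chartAt := c
      mem_chart_source := hx
      chart_mem_atlas := fun x => ⟨x, rfl⟩ }
  have hI : ∀ z, I (I.symm z) = z := fun z => I.right_inv (by rw [I.range_eq_univ]; trivial)
  have hmf : IsManifold (𝓡 N) ∞ S := by
    refine isManifold_of_contDiffOn _ _ _ ?_
    rintro _ _ ⟨x, rfl⟩ ⟨x', rfl⟩
    have h1 : ContDiffOn ℝ ∞ ((χ x').extend I ∘ ((χ x).extend I).symm)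
        (((χ x).extend I).symm.trans ((χ x').extend I)).source :=
      I.contDiffOn_extendCoordChange (hχ x) (hχ x')
    have h2 : ContDiffOn ℝ ∞ (fun u : E₀ => ((L x').symm
        (((χ x').extend I ∘ ((χ x).extend I).symm) (L x (u, 0)))).1)
        ((fun u : E₀ => L x (u, 0)) ⁻¹'
          (((χ x).extend I).symm.trans ((χ x').extend I)).source) := by
      refine contDiff_fst.comp_contDiffOn ((L x').symm.contDiff.comp_contDiffOn ?_)
      refine h1.comp (f := fun u : E₀ => L x (u, 0)) (ContDiff.contDiffOn ?_) fun u hu => hu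
      exact (L x).contDiff.comp (by fun_prop)
    have hsub : ∀ u ∈ ((c x).symm ≫ₕ c x').source, I.symm (L x (u, 0)) ∈ (χ x).target ∧
        (χ x).symm (I.symm (L x (u, 0))) ∈ (χ x').source := by
      intro u hu
      have hu1 : I.symm (L x (u, 0)) ∈ (χ x).target := hu.1
      have hu2 : ((c x).symm u : X) ∈ (χ x').source := hu.2
      rw [coe_sliceChart_symm _ _ _ (hL x) hu1] at hu2
      exact ⟨hu1, hu2⟩
    simp only [modelWithCornersSelf_coe, modelWithCornersSelf_coe_symm, Function.id_comp,
      Function.comp_id, Set.preimage_id, Set.range_id, Set.inter_univ]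
    refine (h2.mono fun u hu => ?_).congr fun u hu => ?_
    · obtain ⟨hu1, hu2⟩ := hsub u hu
      simp [hu1, hu2, I.range_eq_univ ▸ Set.mem_univ (L x (u, 0))]
    · obtain ⟨hu1, hu2⟩ := hsub u hu
      change ((L x').symm (I (χ x' ((c x).symm u : X)))).1 = _
      rw [coe_sliceChart_symm _ _ _ (hL x) hu1]
      rfl
  refine ⟨cs, hmf, ⟨?_, Topology.IsEmbedding.subtypeVal⟩⟩
  refine Manifold.IsImmersionOfComplement.isImmersion (F := F₀) fun x => ?_
  refine Manifold.IsImmersionAtOfComplement.mk_of_charts (L x) (c x) (χ x) (hx x) (hx x)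
    (IsManifold.chart_mem_maximalAtlas x) (hχ x) (fun y hy => hy) fun u hu => ?_
  have hu1 : I.symm (L x (u, 0)) ∈ (χ x).target := by
    have hu' : u ∈ (c x).target := by simpa using hu
    exact hu'
  change I (χ x ((c x).symm u : X)) = L x (u, 0)
  rw [coe_sliceChart_symm _ _ _ (hL x) hu1, (χ x).right_inv hu1, hI]

end Slice

/-! ### A local normal form of the partial prolongation -/

lemma finrank_continuousLinearMap (E F : Type*) [NormedAddCommGroup E] [NormedSpace ℝ E]
    [FiniteDimensional ℝ E] [NormedAddCommGroup F] [NormedSpace ℝ F] [FiniteDimensional ℝ F] :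
    Module.finrank ℝ (E →L[ℝ] F) = Module.finrank ℝ E * Module.finrank ℝ F := by
  rw [← LinearEquiv.finrank_eq (LinearMap.toContinuousLinearMap (𝕜 := ℝ) (E := E) (F' := F)),
    Module.finrank_linearMap]

section Jets

variable {EM : Type*} [NormedAddCommGroup EM] [NormedSpace ℝ EM]
  {M : Type*} [TopologicalSpace M] [ChartedSpace EM M] [IsManifold 𝓘(ℝ, EM) ∞ M]
  {EP : Type*} [NormedAddCommGroup EP] [NormedSpace ℝ EP]
  {P : Type*} [TopologicalSpace P] [ChartedSpace EP P] [IsManifold 𝓘(ℝ, EP) ∞ P]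
  (π : C^∞⟮𝓘(ℝ, EP), P; 𝓘(ℝ, EM), M⟯)

lemma homFiber_baseSet (p₀ : P) :
    (trivializationAt (EM →L[ℝ] EP) (HomFiber π) p₀).baseSet =
      π ⁻¹' (trivializationAt EM (TangentSpace 𝓘(ℝ, EM) : M → Type _) (π p₀)).baseSet ∩
        (trivializationAt EP (TangentSpace 𝓘(ℝ, EP) : P → Type _) p₀).baseSet := by
  rw [hom_trivializationAt_baseSet]
  rfl

/-- In the trivializations at `p₀`, a point `(p, ζ)` of `Hom(π^* TM, TP)` is read by conjugating `ζ`
with the trivializations of `TM` and `TP`. -/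
lemma homFiber_trivializationAt_apply (p₀ p : P) (hp : p ∈
      (trivializationAt (EM →L[ℝ] EP) (HomFiber π) p₀).baseSet) (ζ : HomFiber π p) (v : EM) :
    (trivializationAt (EM →L[ℝ] EP) (HomFiber π) p₀).continuousLinearMapAt ℝ p ζ v =
      (trivializationAt EP (TangentSpace 𝓘(ℝ, EP) : P → Type _) p₀).continuousLinearMapAt ℝ p
        (ζ ((trivializationAt EM (TangentSpace 𝓘(ℝ, EM) : M → Type _) (π p₀)).symmL ℝ
          (π p) v)) := by
  rw [Bundle.Trivialization.continuousLinearMapAt_apply (R := ℝ),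
    Bundle.Trivialization.coe_linearMapAt_of_mem _ hp]
  have h := hom_trivializationAt_apply (σ := RingHom.id ℝ) (E₁ := PullbackTangent π)
    (E₂ := (TangentSpace 𝓘(ℝ, EP) : P → Type _)) (F₁ := EM) (F₂ := EP) p₀ ⟨p, ζ⟩
  change ((trivializationAt (EM →L[ℝ] EP) (HomFiber π) p₀) ⟨p, ζ⟩).2 v = _
  rw [h]
  change (trivializationAt EP (TangentSpace 𝓘(ℝ, EP) : P → Type _) p₀).continuousLinearMapAt ℝ p
        (ζ ((trivializationAt EM (PullbackTangent π) p₀).symmL ℝ p v)) = _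
  congr 2
  rw [homFiber_baseSet] at hp
  let e := trivializationAt EM (TangentSpace 𝓘(ℝ, EM) : M → Type _) (π p₀)
  let e' := trivializationAt EM (PullbackTangent π) p₀
  have hp' : p ∈ e'.baseSet := hp.1
  have hp1 : π p ∈ e.baseSet := hp.1
  -- both sides have the same image under the trivialization of `π^* TM`
  apply (e'.continuousLinearEquivAt ℝ p hp').injective
  have h1 : ∀ w : PullbackTangent π p, e'.continuousLinearEquivAt ℝ p hp' w = (e ⟨π p, w⟩).2 :=
    fun w => rfl
  have h2 : ∀ w : PullbackTangent π p, e'.continuousLinearEquivAt ℝ p hp' w =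
      e'.continuousLinearMapAt ℝ p w := fun w => by
    rw [← e'.coe_continuousLinearEquivAt_eq hp']
  rw [h2, e'.continuousLinearMapAt_symmL hp', h1]
  have h3 := e.continuousLinearMapAt_symmL (R := ℝ) hp1 v
  rw [e.continuousLinearMapAt_apply (R := ℝ), e.coe_linearMapAt_of_mem hp1] at h3
  exact h3.symm

variable (H : ∀ p : P, Submodule ℝ (TangentSpace 𝓘(ℝ, EP) p))

/-- A local normal form of the partial prolongation near `p₀`: after the smooth fibrewise linear
change of coordinates `T`, the fibres of `J¹_H P` become the constant affine space `s₀ + G`, and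
those of `Hom(π^* TM, g(H))` become the constant linear space `G`. -/
structure IsAdapted (p₀ : P) (U : Set P) (T : P → (EM →L[ℝ] EP) ≃L[ℝ] (EM →L[ℝ] EP))
    (s₀ : EM →L[ℝ] EP) (G : Submodule ℝ (EM →L[ℝ] EP)) : Prop where
  isOpen : IsOpen U
  mem : p₀ ∈ U
  subset : U ⊆ (trivializationAt (EM →L[ℝ] EP) (HomFiber π) p₀).baseSet
  smooth : ContMDiffOn 𝓘(ℝ, EP) 𝓘(ℝ, (EM →L[ℝ] EP) →L[ℝ] (EM →L[ℝ] EP)) ∞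
    (fun p => (T p : (EM →L[ℝ] EP) →L[ℝ] (EM →L[ℝ] EP))) U
  smooth_symm : ContMDiffOn 𝓘(ℝ, EP) 𝓘(ℝ, (EM →L[ℝ] EP) →L[ℝ] (EM →L[ℝ] EP)) ∞
    (fun p => ((T p).symm : (EM →L[ℝ] EP) →L[ℝ] (EM →L[ℝ] EP))) U
  mem_iff : ∀ p ∈ U, ∀ ζ : HomFiber π p, (⟨p, ζ⟩ : HomBundle π) ∈ partialProlongation π H ↔
    T p ((trivializationAt (EM →L[ℝ] EP) (HomFiber π) p₀).continuousLinearMapAt ℝ p ζ) - s₀ ∈ G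
  mem_homInto_iff : ∀ p ∈ U, ∀ ζ : HomFiber π p, ζ ∈ homInto π (symbolSpace EM π H) p ↔
    T p ((trivializationAt (EM →L[ℝ] EP) (HomFiber π) p₀).continuousLinearMapAt ℝ p ζ) ∈ G

variable {π H} [FiniteDimensional ℝ EM] [FiniteDimensional ℝ EP]

/-- A Pfaffian fibration has the local normal form near every point, with fibres of constant
dimension: the two conditions on a jet `ζ`, that `dπ ∘ ζ = id` and that `ζ` is killed by a family of
maps with kernel `H`, are one equation `A ∘ ζ = (id, 0)` for a family `A` of surjective maps, and
`A` can be made constant. -/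
theorem exists_isAdapted (hH : IsPfaffianFibration EM π H) : ∃ d : ℕ, ∀ p₀ : P,
    ∃ U T s₀ G, IsAdapted π H p₀ U T s₀ G ∧ Module.finrank ℝ G = d := by
  obtain ⟨k, hk⟩ := hH.isDistribution
  let m := Module.finrank ℝ EM
  let n := Module.finrank ℝ EP
  refine ⟨m * n - m * (m + (n - k)), fun p₀ => ?_⟩
  obtain ⟨U₁, hU₁, hp₁, s, hs⟩ := hk p₀
  let tP := trivializationAt EP (TangentSpace 𝓘(ℝ, EP) : P → Type _) p₀
  let tM := trivializationAt EM (TangentSpace 𝓘(ℝ, EM) : M → Type _) (π p₀)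
  let tH := trivializationAt (EM →L[ℝ] EP) (HomFiber π) p₀
  have hmP : p₀ ∈ tP.baseSet := FiberBundle.mem_baseSet_trivializationAt' p₀
  have hmM : π p₀ ∈ tM.baseSet := FiberBundle.mem_baseSet_trivializationAt' (π p₀)
  -- `H` as the kernel of a family `A₂` of surjective maps, `dπ` as a family `A₁`
  have hs' : IsSmoothFrameOn EP EP H (U₁ ∩ tP.baseSet) s :=
    ⟨fun i => (hs.smooth i).mono Set.inter_subset_left, fun b hb => hs.linearIndependent b hb.1,
      fun b hb => hs.span_eq b hb.1⟩
  obtain ⟨U₂, W, A₂, hU₂, hp₂, hsub₂, hWk, hA₂, hA₂s, hA₂H⟩ := hs'.exists_ker tP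
    (hU₁.inter tP.open_baseSet) Set.inter_subset_right ⟨hp₁, hmP⟩
  let A₁ : P → EP →L[ℝ] EM := fun p => (tM.continuousLinearMapAt ℝ (π p)).comp
        ((mfderiv 𝓘(ℝ, EP) 𝓘(ℝ, EM) π p).comp (tP.symmL ℝ p))
  have hA₁ : ContMDiffOn 𝓘(ℝ, EP) 𝓘(ℝ, EP →L[ℝ] EM) ∞ A₁ (tP.baseSet ∩ π ⁻¹' tM.baseSet) :=
    contMDiffOn_mfderiv_trivialization π.contMDiff tP tM
  let U₃ := U₂ ∩ (tP.baseSet ∩ π ⁻¹' tM.baseSet)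
  have hU₃ : IsOpen U₃ := hU₂.inter
    (tP.open_baseSet.inter (tM.open_baseSet.preimage π.contMDiff.continuous))
  have hp₃ : p₀ ∈ U₃ := ⟨hp₂, hmP, hmM⟩
  let A : P → EP →L[ℝ] (EM × W) := fun p =>
    (ContinuousLinearMap.inl ℝ EM W).comp (A₁ p) + (ContinuousLinearMap.inr ℝ EM W).comp (A₂ p)
  have hA : ContMDiffOn 𝓘(ℝ, EP) 𝓘(ℝ, EP →L[ℝ] (EM × W)) ∞ A U₃ :=
    (contMDiffOn_const.clm_comp (hA₁.mono Set.inter_subset_right)).add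
      (contMDiffOn_const.clm_comp (hA₂.mono Set.inter_subset_left))
  have hA_apply : ∀ p v, A p v = (A₁ p v, A₂ p v) := fun p v => by simp [A]
  have hA₁t : ∀ p ∈ U₃, ∀ v : TangentSpace 𝓘(ℝ, EP) p, A₁ p (tP.continuousLinearMapAt ℝ p v) =
      tM.continuousLinearMapAt ℝ (π p) (mfderiv 𝓘(ℝ, EP) 𝓘(ℝ, EM) π p v) := fun p hp v =>
    congrArg (fun w => tM.continuousLinearMapAt ℝ (π p) (mfderiv 𝓘(ℝ, EP) 𝓘(ℝ, EM) π p w))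
      (tP.symmL_continuousLinearMapAt hp.2.1 v)
  have hA₂t : ∀ p ∈ U₃, ∀ v : TangentSpace 𝓘(ℝ, EP) p,
      A₂ p (tP.continuousLinearMapAt ℝ p v) = 0 ↔ v ∈ H p := fun p hp v => (hA₂H p hp.1 v).symm
  -- transversality of `H` makes `A` surjective
  have hA₀ : Function.Surjective (A p₀) := by
    rintro ⟨a, b⟩
    obtain ⟨x, hx⟩ := hA₂s p₀ hp₂ b
    obtain ⟨y, hy⟩ := hH.isFibration.submersion p₀ (tM.symmL ℝ (π p₀) (a - A₁ p₀ x))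
    obtain ⟨v, hv, h, hh, rfl⟩ := Submodule.mem_sup.1
      ((hH.transversal p₀).symm ▸ Submodule.mem_top : y ∈ vertical EP EM π p₀ ⊔ H p₀)
    have hv' : mfderiv 𝓘(ℝ, EP) 𝓘(ℝ, EM) π p₀ v = 0 := hv
    rw [map_add, hv', zero_add] at hy
    refine ⟨x + tP.continuousLinearMapAt ℝ p₀ h, ?_⟩
    rw [map_add, hA_apply, hA_apply, hA₁t p₀ hp₃, (hA₂t p₀ hp₃ h).2 hh, hy,
      tM.continuousLinearMapAt_symmL hmM, hx]
    simp
  obtain ⟨U, τ, hU, hp₀, hsub, hτ, hτs, hτs'⟩ := exists_straightening hU₃ hp₃ hA hA₀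
  obtain ⟨R, hR⟩ := LinearMap.exists_rightInverse_of_surjective (A p₀).toLinearMap
    (LinearMap.range_eq_top.2 hA₀)
  have hR' : ∀ w, A p₀ (R w) = w := fun w => congrArg (fun f => f w) hR
  let R' : (EM × W) →L[ℝ] EP := LinearMap.toContinuousLinearMap R
  let T : P → (EM →L[ℝ] EP) ≃L[ℝ] (EM →L[ℝ] EP) := fun p =>
    (ContinuousLinearEquiv.refl ℝ EM).arrowCongr (τ p)
  have hT : ∀ p η v, T p η v = τ p (η v) := fun p η v => rfl
  -- `G` is the kernel of `C`, postcomposition with `A p₀`; `s₀` solves `A p₀ ∘ s₀ = (id, 0)`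
  let C : (EM →L[ℝ] EP) →ₗ[ℝ] (EM →L[ℝ] EM × W) :=
    (ContinuousLinearMap.compL ℝ EM EP (EM × W) (A p₀)).toLinearMap
  have hC : ∀ η, C η = 0 ↔ ∀ v, A p₀ (η v) = 0 := fun η => ContinuousLinearMap.ext_iff
  have hbase : ∀ p ∈ U, p ∈ tH.baseSet := fun p hp => by
    rw [homFiber_baseSet]
    exact ⟨(hsub hp).2.2, (hsub hp).2.1⟩
  have key : ∀ p ∈ U, ∀ (ζ : HomFiber π p) (v : EM),
      A p₀ (T p (tH.continuousLinearMapAt ℝ p ζ) v) =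
        (tM.continuousLinearMapAt ℝ (π p) (mfderiv 𝓘(ℝ, EP) 𝓘(ℝ, EM) π p
          (ζ (tM.symmL ℝ (π p) v))),
        A₂ p (tP.continuousLinearMapAt ℝ p (ζ (tM.symmL ℝ (π p) v)))) := by
    intro p hp ζ v
    rw [hT, ← hτ p hp, homFiber_trivializationAt_apply π p₀ p (hbase p hp), hA_apply,
      hA₁t p (hsub hp)]
  have hmem : ∀ p ∈ U, ∀ ζ : HomFiber π p,
      (∀ v : EM, A₂ p (tP.continuousLinearMapAt ℝ p (ζ (tM.symmL ℝ (π p) v))) = 0) ↔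
        ∀ v, ζ v ∈ H p := by
    intro p hp ζ
    have hpM : π p ∈ tM.baseSet := (hsub hp).2.2
    constructor
    · intro h v
      have := (hA₂t p (hsub hp) _).1 (h (tM.continuousLinearMapAt ℝ (π p) v))
      rwa [tM.symmL_continuousLinearMapAt hpM] at this
    · exact fun h v => (hA₂t p (hsub hp) _).2 (h _)
  refine ⟨U, T, R'.comp (ContinuousLinearMap.inl ℝ EM W), LinearMap.ker C,
    ⟨hU, hp₀, hbase, hτs.clm_postcomp, hτs'.clm_postcomp, fun p hp ζ => ?_, fun p hp ζ => ?_⟩, ?_⟩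
  · have hpM : π p ∈ tM.baseSet := (hsub hp).2.2
    have hiff : T p (tH.continuousLinearMapAt ℝ p ζ) - R'.comp (ContinuousLinearMap.inl ℝ EM W) ∈
        LinearMap.ker C ↔ ∀ v : EM, A p₀ (T p (tH.continuousLinearMapAt ℝ p ζ) v) = (v, 0) := by
      rw [LinearMap.mem_ker, hC]
      refine forall_congr' fun v => ?_
      have : A p₀ (R'.comp (ContinuousLinearMap.inl ℝ EM W) v) = (v, 0) := hR' _
      rw [sub_apply, map_sub, this, sub_eq_zero]
    rw [hiff]
    simp only [key p hp, Prod.mk.injEq, forall_and]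
    rw [hmem p hp]
    refine and_congr_left fun _ => ?_
    constructor
    · intro h v
      have := h (tM.symmL ℝ (π p) v)
      exact (congrArg (tM.continuousLinearMapAt ℝ (π p)) this).trans
        (tM.continuousLinearMapAt_symmL hpM v)
    · intro h w
      have := h (tM.continuousLinearMapAt ℝ (π p) w)
      rw [tM.symmL_continuousLinearMapAt hpM] at this
      exact (tM.continuousLinearEquivAt ℝ (π p) hpM).injective (by
        rw [tM.coe_continuousLinearEquivAt_eq hpM]; exact this)
  · have hpM : π p ∈ tM.baseSet := (hsub hp).2.2
    have hiff : T p (tH.continuousLinearMapAt ℝ p ζ) ∈ LinearMap.ker C ↔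
        ∀ v : EM, A p₀ (T p (tH.continuousLinearMapAt ℝ p ζ) v) = 0 := by
      rw [LinearMap.mem_ker, hC]
    rw [hiff]
    simp only [key p hp, Prod.mk_eq_zero, forall_and]
    rw [hmem p hp]
    change (∀ v, mfderiv 𝓘(ℝ, EP) 𝓘(ℝ, EM) π p (ζ v) = 0 ∧ ζ v ∈ H p) ↔ _
    rw [forall_and]
    refine and_congr_left fun _ => ?_
    constructor
    · intro h v
      exact (congrArg (tM.continuousLinearMapAt ℝ (π p)) (h _)).trans (map_zero _)
    · intro h w
      have := h (tM.continuousLinearMapAt ℝ (π p) w)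
      rw [tM.symmL_continuousLinearMapAt hpM] at this
      exact (tM.continuousLinearEquivAt ℝ (π p) hpM).injective (by
        rw [tM.coe_continuousLinearEquivAt_eq hpM, map_zero]; exact this)
  · have hCs : LinearMap.range C = ⊤ := LinearMap.range_eq_top.2 fun θ =>
      ⟨R'.comp θ, ContinuousLinearMap.ext fun v => hR' (θ v)⟩
    have h1 := C.finrank_range_add_finrank_ker
    rw [hCs, finrank_top, finrank_continuousLinearMap, finrank_continuousLinearMap,
      Module.finrank_prod] at h1
    have hW : Module.finrank ℝ W = n - k := by omega
    rw [hW] at h1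
    change m * (m + (n - k)) + _ = m * n at h1
    omega

end Jets

/-! ### The partial prolongation as an embedded submanifold -/

section Jets

variable {EM : Type*} [NormedAddCommGroup EM] [NormedSpace ℝ EM]
  {M : Type*} [TopologicalSpace M] [ChartedSpace EM M] [IsManifold 𝓘(ℝ, EM) ∞ M]
  {EP : Type*} [NormedAddCommGroup EP] [NormedSpace ℝ EP]
  {P : Type*} [TopologicalSpace P] [ChartedSpace EP P] [IsManifold 𝓘(ℝ, EP) ∞ P]
  {π : C^∞⟮𝓘(ℝ, EP), P; 𝓘(ℝ, EM), M⟯} {H : ∀ p : P, Submodule ℝ (TangentSpace 𝓘(ℝ, EP) p)}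
  {p₀ : P} {U : Set P} {T : P → (EM →L[ℝ] EP) ≃L[ℝ] (EM →L[ℝ] EP)}
  {s₀ : EM →L[ℝ] EP} {G : Submodule ℝ (EM →L[ℝ] EP)}

/-- The diffeomorphism from the part of `Hom(π^* TM, TP)` over `U` onto `U × Hom(EM, EP)` which
carries `J¹_H P` to `U × G`. -/
noncomputable def IsAdapted.diffeo (h : IsAdapted π H p₀ U T s₀ G) :
    PartialDiffeomorph (𝓘(ℝ, EP).prod 𝓘(ℝ, EM →L[ℝ] EP)) (𝓘(ℝ, EP).prod 𝓘(ℝ, EM →L[ℝ] EP))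
      (HomBundle π) (P × (EM →L[ℝ] EP)) ∞ where
  toFun ξ := (ξ.proj, T ξ.proj ((trivializationAt (EM →L[ℝ] EP) (HomFiber π)
    p₀).continuousLinearMapAt ℝ ξ.proj ξ.snd) - s₀)
  invFun x := ⟨x.1, (trivializationAt (EM →L[ℝ] EP) (HomFiber π) p₀).symmL ℝ x.1
    ((T x.1).symm (x.2 + s₀))⟩
  source := Bundle.TotalSpace.proj ⁻¹' U
  target := U ×ˢ Set.univ
  map_source' ξ hξ := ⟨hξ, trivial⟩
  map_target' x hx := hx.1
  left_inv' ξ hξ := by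
    simp only [sub_add_cancel, ContinuousLinearEquiv.symm_apply_apply]
    rw [Bundle.Trivialization.symmL_continuousLinearMapAt _ (h.subset hξ)]
  right_inv' x hx := by
    simp only
    rw [Bundle.Trivialization.continuousLinearMapAt_symmL _ (h.subset hx.1)]
    simp
  open_source := h.isOpen.preimage (FiberBundle.continuous_proj _ _)
  open_target := h.isOpen.prod isOpen_univ
  contMDiffOn_toFun := by
    let e := trivializationAt (EM →L[ℝ] EP) (HomFiber π) p₀
    have h1 : ContMDiffOn (𝓘(ℝ, EP).prod 𝓘(ℝ, EM →L[ℝ] EP)) 𝓘(ℝ, EP) ∞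
        (fun ξ : HomBundle π => ξ.proj) (Bundle.TotalSpace.proj ⁻¹' U) :=
      Bundle.contMDiffOn_proj (HomFiber π)
    have h2 : ContMDiffOn (𝓘(ℝ, EP).prod 𝓘(ℝ, EM →L[ℝ] EP)) 𝓘(ℝ, EM →L[ℝ] EP) ∞
        (fun ξ : HomBundle π => e.continuousLinearMapAt ℝ ξ.proj ξ.snd)
        (Bundle.TotalSpace.proj ⁻¹' U) := by
      have := contMDiff_snd.comp_contMDiffOn (e.contMDiffOn (IB := 𝓘(ℝ, EP)) (n := ∞))
      refine (this.mono fun ξ hξ => e.mem_source.2 (h.subset hξ)).congr fun ξ hξ => ?_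
      rw [e.continuousLinearMapAt_apply (R := ℝ), e.coe_linearMapAt_of_mem (h.subset hξ)]
      rfl
    exact h1.prodMk (((h.smooth.comp h1 fun ξ hξ => hξ).clm_apply h2).sub contMDiffOn_const)
  contMDiffOn_invFun := by
    let e := trivializationAt (EM →L[ℝ] EP) (HomFiber π) p₀
    have h1 : ContMDiffOn (𝓘(ℝ, EP).prod 𝓘(ℝ, EM →L[ℝ] EP)) 𝓘(ℝ, EM →L[ℝ] EP) ∞
        (fun x : P × (EM →L[ℝ] EP) => (T x.1).symm (x.2 + s₀)) (U ×ˢ Set.univ) :=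
      (h.smooth_symm.comp contMDiffOn_fst fun x hx => hx.1).clm_apply
        (contMDiffOn_snd.add contMDiffOn_const)
    refine (e.contMDiffOn_iff fun x hx => e.mem_source.2 (h.subset hx.1)).2
      ⟨contMDiffOn_fst, h1.congr fun x hx => ?_⟩
    have := e.continuousLinearMapAt_symmL (R := ℝ) (h.subset hx.1) ((T x.1).symm (x.2 + s₀))
    rwa [e.continuousLinearMapAt_apply (R := ℝ), e.coe_linearMapAt_of_mem (h.subset hx.1)] at this

lemma IsAdapted.mem_iff_diffeo (h : IsAdapted π H p₀ U T s₀ G) {ξ : HomBundle π}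
    (hξ : ξ.proj ∈ U) : ξ ∈ partialProlongation π H ↔ (h.diffeo ξ).2 ∈ G :=
  h.mem_iff ξ.proj hξ ξ.snd

variable [FiniteDimensional ℝ EM] [FiniteDimensional ℝ EP]

/-- The partial prolongation is an embedded submanifold of `Hom(π^* TM, TP)`. -/
theorem exists_isSmoothEmbedding_partialProlongation {d : ℕ} (h : ∀ p₀ : P,
    ∃ U T s₀ G, IsAdapted π H p₀ U T s₀ G ∧ Module.finrank ℝ G = d) :
    ∃ (_ : ChartedSpace (EuclideanSpace ℝ (Fin (Module.finrank ℝ EP + d)))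
        (partialProlongation π H))
      (_ : IsManifold (𝓡 (Module.finrank ℝ EP + d)) ∞ (partialProlongation π H)),
      Manifold.IsSmoothEmbedding (𝓡 (Module.finrank ℝ EP + d))
        (𝓘(ℝ, EP).prod 𝓘(ℝ, EM →L[ℝ] EP)) ∞
        (fun ξ : partialProlongation π H => ξ.1) := by
  refine exists_isSmoothEmbedding_of_slices fun ξ hξ => ?_
  obtain ⟨U, T, s₀, G, hA, hG⟩ := h ξ.proj
  let c : OpenPartialHomeomorph (P × (EM →L[ℝ] EP)) (ModelProd EP (EM →L[ℝ] EP)) :=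
    (chartAt EP ξ.proj).prod (OpenPartialHomeomorph.refl _)
  have hc : c ∈ IsManifold.maximalAtlas (𝓘(ℝ, EP).prod 𝓘(ℝ, EM →L[ℝ] EP)) ∞
      (P × (EM →L[ℝ] EP)) := by
    have : c = chartAt (ModelProd EP (EM →L[ℝ] EP)) (ξ.proj, (0 : EM →L[ℝ] EP)) := by
      simp [c, chartAt_self_eq]
    rw [this]
    exact IsManifold.chart_mem_maximalAtlas _
  let χ : OpenPartialHomeomorph (HomBundle π) (ModelProd EP (EM →L[ℝ] EP)) :=
    hA.diffeo.toOpenPartialHomeomorph ≫ₕ c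
  refine ⟨χ, ?_, ⟨hA.mem, mem_chart_source EP ξ.proj, trivial⟩,
    LinearMap.range ((LinearMap.id : EP →ₗ[ℝ] EP).prodMap G.subtype), ?_,
    fun η hη => ?_⟩
  · refine OpenPartialHomeomorph.mem_maximalAtlas_of_contMDiffOn χ ?_ ?_
    · exact (contMDiffOn_of_mem_maximalAtlas hc).comp
        (hA.diffeo.contMDiffOn_toFun.mono Set.inter_subset_left) fun x hx => hx.2
    · exact hA.diffeo.contMDiffOn_invFun.comp
        ((contMDiffOn_symm_of_mem_maximalAtlas hc).mono Set.inter_subset_left) fun x hx => hx.2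
  · rw [LinearMap.finrank_range_of_inj, Module.finrank_prod, hG]
    exact Function.injective_id.prodMap G.injective_subtype
  · rw [hA.mem_iff_diffeo hη.1]
    exact ⟨fun hη => ⟨((χ η).1, ⟨_, hη⟩), rfl⟩, fun ⟨x, hx⟩ => (congrArg Prod.snd hx) ▸ x.2.2⟩

end Jets

/-! ### The partial prolongation as an affine bundle -/

section Jets

variable {EM : Type*} [NormedAddCommGroup EM] [NormedSpace ℝ EM]
  {M : Type*} [TopologicalSpace M] [ChartedSpace EM M] [IsManifold 𝓘(ℝ, EM) ∞ M]
  {EP : Type*} [NormedAddCommGroup EP] [NormedSpace ℝ EP]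
  {P : Type*} [TopologicalSpace P] [ChartedSpace EP P] [IsManifold 𝓘(ℝ, EP) ∞ P]
  {π : C^∞⟮𝓘(ℝ, EP), P; 𝓘(ℝ, EM), M⟯} {H : ∀ p : P, Submodule ℝ (TangentSpace 𝓘(ℝ, EP) p)}
  {p₀ : P} {U : Set P} {T : P → (EM →L[ℝ] EP) ≃L[ℝ] (EM →L[ℝ] EP)}
  {s₀ : EM →L[ℝ] EP} {G : Submodule ℝ (EM →L[ℝ] EP)}

/-- A point of `Hom(π^* TM, TP)` given in an adapted trivialization by `η` lies in `J¹_H P` if and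
only if `η` lies in `G`. -/
lemma IsAdapted.mem_iff_symm (h : IsAdapted π H p₀ U T s₀ G) {p : P} (hp : p ∈ U)
    (η : EM →L[ℝ] EP) : h.diffeo.symm (p, η) ∈ partialProlongation π H ↔ η ∈ G := by
  have hx : (p, η) ∈ h.diffeo.target := ⟨hp, trivial⟩
  have h1 : h.diffeo (h.diffeo.symm (p, η)) = (p, η) := h.diffeo.right_inv hx
  have h2 : (h.diffeo.symm (p, η)).proj ∈ U := hp
  rw [h.mem_iff_diffeo h2, h1]

variable [FiniteDimensional ℝ EM] [FiniteDimensional ℝ EP]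
  {EA : Type*} [NormedAddCommGroup EA] [NormedSpace ℝ EA]
  [ChartedSpace EA (partialProlongation π H)]

/-- The local affine trivializations of `J¹_H P → P`. -/
theorem IsAdapted.exists_partialDiffeomorph (h : IsAdapted π H p₀ U T s₀ G)
    (hemb : Manifold.IsSmoothEmbedding 𝓘(ℝ, EA) (𝓘(ℝ, EP).prod 𝓘(ℝ, EM →L[ℝ] EP)) ∞
        (fun ξ : partialProlongation π H => ξ.1))
    {k : ℕ} (c : Module.Basis (Fin k) ℝ G) :
    ∃ Ψ : PartialDiffeomorph (𝓘(ℝ, EP).prod 𝓘(ℝ, Fin k → ℝ)) 𝓘(ℝ, EA)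
        (P × (Fin k → ℝ)) (partialProlongation π H) ∞,
      Ψ.source = U ×ˢ Set.univ ∧ Ψ.target = {a | a.1.proj ∈ U} ∧
      ∀ p ∈ U, ∀ t : Fin k → ℝ,
        (Ψ (p, t)).1 = h.diffeo.symm (p, ∑ i, t i • (c i : EM →L[ℝ] EP)) := by
  classical
  have hmem : ∀ p ∈ U, ∀ t : Fin k → ℝ,
      h.diffeo.symm (p, ∑ i, t i • (c i : EM →L[ℝ] EP)) ∈ partialProlongation π H :=
    fun p hp t => (h.mem_iff_symm hp _).2
      (Submodule.sum_mem _ fun i _ => G.smul_mem _ (c i).2)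
  obtain ⟨q, hq⟩ := G.subtype.exists_leftInverse_of_injective G.ker_subtype
  have hq' : ∀ g : G, q g = g := fun g => congrArg (fun f => f g) hq
  -- `κ` gives the coordinates of the elements of `G` in the basis `c`
  let κ : (EM →L[ℝ] EP) →ₗ[ℝ] (Fin k → ℝ) := c.equivFun.toLinearMap ∘ₗ q
  have hκ : ∀ t : Fin k → ℝ, κ (∑ i, t i • (c i : EM →L[ℝ] EP)) = t := by
    intro t
    have : (∑ i, t i • (c i : EM →L[ℝ] EP)) = ((∑ i, t i • c i : G) : EM →L[ℝ] EP) := by simp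
    rw [this]
    change c.equivFun (q _) = t
    rw [hq', ← c.equivFun_symm_apply, LinearEquiv.apply_symm_apply]
  have hκ' : ∀ g ∈ G, ∑ i, κ g i • (c i : EM →L[ℝ] EP) = g := by
    intro g hg
    have : κ g = c.equivFun ⟨g, hg⟩ := congrArg c.equivFun (hq' ⟨g, hg⟩)
    rw [this]
    have h2 := congrArg G.subtype (c.sum_equivFun ⟨g, hg⟩)
    rw [map_sum] at h2
    exact h2
  -- the value of `F` outside `U` is irrelevant
  let ξ₀ : partialProlongation π H := ⟨_, hmem p₀ h.mem 0⟩
  let F : P × (Fin k → ℝ) → partialProlongation π H := fun x =>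
    if hx : x.1 ∈ U then ⟨_, hmem x.1 hx x.2⟩ else ξ₀
  have hF : ∀ x : P × (Fin k → ℝ), x.1 ∈ U →
      (F x).1 = h.diffeo.symm (x.1, ∑ i, x.2 i • (c i : EM →L[ℝ] EP)) := fun x hx => by
    simp only [F, dif_pos hx]
  have hopen : IsOpen (U ×ˢ (Set.univ : Set (Fin k → ℝ))) := h.isOpen.prod isOpen_univ
  have hFs : ContMDiffOn (𝓘(ℝ, EP).prod 𝓘(ℝ, Fin k → ℝ)) (𝓘(ℝ, EP).prod 𝓘(ℝ, EM →L[ℝ] EP)) ∞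
      (fun x => (F x).1) (U ×ˢ Set.univ) := by
    have h1 : ContMDiff (𝓘(ℝ, EP).prod 𝓘(ℝ, Fin k → ℝ)) 𝓘(ℝ, EM →L[ℝ] EP) ∞
        (fun x : P × (Fin k → ℝ) => ∑ i, x.2 i • (c i : EM →L[ℝ] EP)) :=
      ((∑ i, (ContinuousLinearMap.proj (R := ℝ) (φ := fun _ : Fin k => ℝ) i).smulRight
        (c i : EM →L[ℝ] EP)).contMDiff.comp contMDiff_snd).congr fun x => by simp
    exact (h.diffeo.contMDiffOn_invFun.comp (contMDiff_fst.prodMk h1).contMDiffOn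
      fun x hx => ⟨hx.1, trivial⟩).congr fun x hx => hF x hx.1
  let Ψ : PartialDiffeomorph (𝓘(ℝ, EP).prod 𝓘(ℝ, Fin k → ℝ)) 𝓘(ℝ, EA)
        (P × (Fin k → ℝ)) (partialProlongation π H) ∞ :=
    { toFun := F
      invFun := fun ξ => (ξ.1.proj, κ (h.diffeo ξ.1).2)
      source := U ×ˢ Set.univ
      target := {a | a.1.proj ∈ U}
      map_source' := fun x hx => by
        change (F x).1.proj ∈ U
        rw [hF x hx.1]
        exact hx.1
      map_target' := fun ξ hξ => ⟨hξ, trivial⟩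
      left_inv' := fun x hx => by
        have h1 : h.diffeo (h.diffeo.symm (x.1, ∑ i, x.2 i • (c i : EM →L[ℝ] EP))) = _ :=
          h.diffeo.right_inv (⟨hx.1, trivial⟩ : (x.1, _) ∈ h.diffeo.target)
        rw [hF x hx.1, h1]
        exact Prod.ext rfl (hκ x.2)
      right_inv' := fun ξ hξ => by
        apply Subtype.ext
        rw [hF (ξ.1.proj, _) hξ]
        dsimp only
        rw [hκ' _ ((h.mem_iff_diffeo hξ).1 ξ.2)]
        exact h.diffeo.left_inv hξ
      open_source := hopen
      open_target := h.isOpen.preimage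
        ((FiberBundle.continuous_proj _ _).comp continuous_subtype_val)
      -- smoothness into the embedded submanifold is smoothness into `Hom(π^* TM, TP)`
      contMDiffOn_toFun := fun x hx => by
        refine ContMDiffAt.contMDiffWithinAt ?_
        have h2 := (hFs x hx).contMDiffAt (hopen.mem_nhds hx)
        rw [ContMDiffAt.iff_comp_isImmersionAt (hemb.isImmersion.isImmersionAt (F x))]
        exact ⟨hemb.isEmbedding.isInducing.continuousAt_iff.2 h2.continuousAt, h2⟩
      contMDiffOn_invFun := by
        have h1 : ContMDiffOn 𝓘(ℝ, EA) (𝓘(ℝ, EP).prod 𝓘(ℝ, EM →L[ℝ] EP)) ∞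
            (fun ξ : partialProlongation π H => h.diffeo ξ.1) {a | a.1.proj ∈ U} :=
          h.diffeo.contMDiffOn_toFun.comp hemb.contMDiff.contMDiffOn fun ξ hξ => hξ
        exact (contMDiff_fst.comp_contMDiffOn h1).prodMk
          ((LinearMap.toContinuousLinearMap κ).contMDiff.comp_contMDiffOn
            (contMDiff_snd.comp_contMDiffOn h1)) }
  exact ⟨Ψ, rfl, rfl, fun p hp t => hF (p, t) hp⟩

/-- The partial prolongation is an affine bundle modelled on `Hom(π^* TM, g(H))`. -/
theorem isAffineBundle_partialProlongation {d : ℕ} (h : ∀ p₀ : P,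
      ∃ U T s₀ G, IsAdapted π H p₀ U T s₀ G ∧ Module.finrank ℝ G = d)
    (hemb : Manifold.IsSmoothEmbedding 𝓘(ℝ, EA) (𝓘(ℝ, EP).prod 𝓘(ℝ, EM →L[ℝ] EP)) ∞
        (fun ξ : partialProlongation π H => ξ.1)) :
    IsAffineBundle EP EA (partialProlongation π H) (homInto π (symbolSpace EM π H)) where
  isVectorSubbundle := ⟨d, fun p₀ => by
    obtain ⟨U, T, s₀, G, hA, hG⟩ := h p₀
    exact ⟨U, hA.isOpen, hA.mem, _, isSmoothFrameOn_symm _ hA.isOpen hA.subset hA.smooth_symm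
      (Module.finBasisOfFinrankEq ℝ G hG) hA.mem_homInto_iff⟩⟩
  nonempty p₀ := by
    obtain ⟨U, T, s₀, G, hA, hG⟩ := h p₀
    exact ⟨_, (hA.mem_iff_symm hA.mem 0).2 G.zero_mem⟩
  sub_mem_iff p₀ ξ η hξ := by
    obtain ⟨U, T, s₀, G, hA, hG⟩ := h p₀
    rw [hA.mem_iff p₀ hA.mem] at hξ
    rw [hA.mem_iff p₀ hA.mem, hA.mem_homInto_iff p₀ hA.mem, map_sub, map_sub,
      ← G.sub_mem_iff_left hξ]
    simp
  locally_trivial p₀ := by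
    obtain ⟨U, T, s₀, G, hA, hG⟩ := h p₀
    let c := Module.finBasisOfFinrankEq ℝ G hG
    let e := trivializationAt (EM →L[ℝ] EP) (HomFiber π) p₀
    obtain ⟨Ψ, h1, h2, h3⟩ := hA.exists_partialDiffeomorph hemb c
    refine ⟨U, hA.isOpen, hA.mem, d, fun p => e.symmL ℝ p ((T p).symm s₀), _,
      isSmoothFrameOn_symm e hA.isOpen hA.subset hA.smooth_symm c hA.mem_homInto_iff,
      Ψ, h1, h2, fun p hp t => ?_⟩
    rw [h3 p hp]
    change (⟨p, e.symmL ℝ p ((T p).symm (_ + s₀))⟩ : HomBundle π) = _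
    congr 1
    rw [add_comm, map_add, map_add, map_sum, map_sum]
    simp only [map_smul]

end Jets

/-! ### The Cartan distribution -/

section Jets

variable {EM : Type*} [NormedAddCommGroup EM] [NormedSpace ℝ EM]
  {M : Type*} [TopologicalSpace M] [ChartedSpace EM M] [IsManifold 𝓘(ℝ, EM) ∞ M]
  {EP : Type*} [NormedAddCommGroup EP] [NormedSpace ℝ EP]
  {P : Type*} [TopologicalSpace P] [ChartedSpace EP P] [IsManifold 𝓘(ℝ, EP) ∞ P]
  {π : C^∞⟮𝓘(ℝ, EP), P; 𝓘(ℝ, EM), M⟯} {H : ∀ p : P, Submodule ℝ (TangentSpace 𝓘(ℝ, EP) p)}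
  {EQ : Type*} [NormedAddCommGroup EQ] [NormedSpace ℝ EQ]
  {Q : Type*} [TopologicalSpace Q] [ChartedSpace EQ Q]
  {f : Q → HomBundle π}

lemma contMDiff_proj_comp (hf : ContMDiff 𝓘(ℝ, EQ) (𝓘(ℝ, EP).prod 𝓘(ℝ, EM →L[ℝ] EP)) ∞ f) :
    ContMDiff 𝓘(ℝ, EQ) 𝓘(ℝ, EP) ∞ (fun x => (f x).proj) :=
  (Bundle.contMDiff_proj (HomFiber π)).comp hf

/-- A vector lies in the Cartan distribution at `(p, ζ)` if and only if its image in `T_p P` is the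
`ζ`-lift of its image in `TM`. -/
lemma mem_cartanDistribution_iff
    (hf : ContMDiff 𝓘(ℝ, EQ) (𝓘(ℝ, EP).prod 𝓘(ℝ, EM →L[ℝ] EP)) ∞ f) (x : Q)
    (v : TangentSpace 𝓘(ℝ, EQ) x) :
    v ∈ cartanDistribution EQ π f x ↔
      mfderiv 𝓘(ℝ, EQ) 𝓘(ℝ, EP) (fun x => (f x).proj) x v =
        (f x).snd (mfderiv 𝓘(ℝ, EP) 𝓘(ℝ, EM) π (f x).proj
          (mfderiv 𝓘(ℝ, EQ) 𝓘(ℝ, EP) (fun x => (f x).proj) x v)) := by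
  have h : mfderiv 𝓘(ℝ, EQ) 𝓘(ℝ, EP) (fun x => (f x).proj) x v = prDeriv π (f x)
      (mfderiv 𝓘(ℝ, EQ) (𝓘(ℝ, EP).prod 𝓘(ℝ, EM →L[ℝ] EP)) f x v) := by
    have h1 := mfderiv_comp (I := 𝓘(ℝ, EQ)) (I' := 𝓘(ℝ, EP).prod 𝓘(ℝ, EM →L[ℝ] EP))
      (I'' := 𝓘(ℝ, EP)) (f := f) (g := fun η : HomBundle π => η.proj) x
      ((Bundle.contMDiff_proj (n := ∞) (IB := 𝓘(ℝ, EP)) (F := EM →L[ℝ] EP)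
        (HomFiber π)).contMDiffAt.mdifferentiableAt (by simp))
      (hf.contMDiffAt.mdifferentiableAt (by simp))
    exact congrArg (fun L => L v) h1
  rw [h]
  exact sub_eq_zero

lemma mfderiv_comp_proj
    (hf : ContMDiff 𝓘(ℝ, EQ) (𝓘(ℝ, EP).prod 𝓘(ℝ, EM →L[ℝ] EP)) ∞ f) (x : Q)
    (v : TangentSpace 𝓘(ℝ, EQ) x) :
    mfderiv 𝓘(ℝ, EQ) 𝓘(ℝ, EM) (fun x => π (f x).proj) x v =
      mfderiv 𝓘(ℝ, EP) 𝓘(ℝ, EM) π (f x).proj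
          (mfderiv 𝓘(ℝ, EQ) 𝓘(ℝ, EP) (fun x => (f x).proj) x v) := by
  have h1 := mfderiv_comp (I := 𝓘(ℝ, EQ)) (I' := 𝓘(ℝ, EP))
      (I'' := 𝓘(ℝ, EM)) (f := fun x => (f x).proj) (g := π) x
      (π.contMDiff.contMDiffAt.mdifferentiableAt (by simp))
      ((contMDiff_proj_comp hf).contMDiffAt.mdifferentiableAt (by simp))
  exact congrArg (fun L => L v) h1

/-- If `d pr` maps the Cartan distribution into `H` and `pr` is a submersion, then every jet takes
values in `H`: the `ζ`-lifts are the images of the Cartan vectors. -/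
theorem mem_partialProlongation_of_map_cartanDistribution
    (hf : ContMDiff 𝓘(ℝ, EQ) (𝓘(ℝ, EP).prod 𝓘(ℝ, EM →L[ℝ] EP)) ∞ f)
    (hjet : ∀ x, f x ∈ jetBundle π)
    (hsub : ∀ x, Function.Surjective (mfderiv 𝓘(ℝ, EQ) 𝓘(ℝ, EP) (fun x => (f x).proj) x))
    (hmap : ∀ x, ∀ v ∈ cartanDistribution EQ π f x,
      mfderiv 𝓘(ℝ, EQ) 𝓘(ℝ, EP) (fun x => (f x).proj) x v ∈ H (f x).proj) (x : Q) :
    f x ∈ partialProlongation π H := by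
  refine ⟨hjet x, fun v => ?_⟩
  obtain ⟨w, hw⟩ := hsub x ((f x).snd v)
  have := hmap x w ((mem_cartanDistribution_iff hf x w).2 (by rw [hw, hjet x v]))
  rwa [hw] at this

/-- Where `pr` is a submersion, the Cartan distribution is transversal to the fibres over `M`. -/
theorem vertical_sup_cartanDistribution
    (hf : ContMDiff 𝓘(ℝ, EQ) (𝓘(ℝ, EP).prod 𝓘(ℝ, EM →L[ℝ] EP)) ∞ f)
    (hjet : ∀ x, f x ∈ jetBundle π)
    (hsub : ∀ x, Function.Surjective (mfderiv 𝓘(ℝ, EQ) 𝓘(ℝ, EP) (fun x => (f x).proj) x))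
    (x : Q) :
    vertical EQ EM (fun x => π (f x).proj) x ⊔ cartanDistribution EQ π f x = ⊤ := by
  rw [eq_top_iff]
  intro v _
  obtain ⟨w, hw⟩ := hsub x ((f x).snd (mfderiv 𝓘(ℝ, EQ) 𝓘(ℝ, EM) (fun x => π (f x).proj) x v))
  have h1 : mfderiv 𝓘(ℝ, EQ) 𝓘(ℝ, EM) (fun x => π (f x).proj) x w =
      mfderiv 𝓘(ℝ, EQ) 𝓘(ℝ, EM) (fun x => π (f x).proj) x v := by
    rw [mfderiv_comp_proj hf, hw, hjet x]
  refine Submodule.mem_sup.2 ⟨v - w, ?_, w, ?_, sub_add_cancel v w⟩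
  · change mfderiv 𝓘(ℝ, EQ) 𝓘(ℝ, EM) (fun x => π (f x).proj) x (v - w) = 0
    rw [map_sub, h1, sub_self]
  · rw [mem_cartanDistribution_iff hf, hw, hjet x]

/-- The symbol space of the Cartan distribution is the vertical bundle of `pr`. -/
theorem symbolSpace_cartanDistribution
    (hf : ContMDiff 𝓘(ℝ, EQ) (𝓘(ℝ, EP).prod 𝓘(ℝ, EM →L[ℝ] EP)) ∞ f) :
    symbolSpace EM (fun x => π (f x).proj) (cartanDistribution EQ π f) =
      vertical EQ EP (fun x => (f x).proj) := by
  ext x v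
  change mfderiv 𝓘(ℝ, EQ) 𝓘(ℝ, EM) (fun x => π (f x).proj) x v = 0 ∧
      v ∈ cartanDistribution EQ π f x ↔
    mfderiv 𝓘(ℝ, EQ) 𝓘(ℝ, EP) (fun x => (f x).proj) x v = 0
  rw [mem_cartanDistribution_iff hf, mfderiv_comp_proj hf]
  constructor
  · rintro ⟨h1, h2⟩
    rw [h2, h1, map_zero]
  · intro h
    rw [h, map_zero, map_zero]
    exact ⟨rfl, rfl⟩

/-- `d pr` maps the Cartan distribution of the partial prolongation into `H`. -/
theorem map_cartanDistribution_mem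
    (hf : ContMDiff 𝓘(ℝ, EQ) (𝓘(ℝ, EP).prod 𝓘(ℝ, EM →L[ℝ] EP)) ∞ f)
    (hmem : ∀ x, f x ∈ partialProlongation π H) (x : Q) {v : TangentSpace 𝓘(ℝ, EQ) x}
    (hv : v ∈ cartanDistribution EQ π f x) :
    mfderiv 𝓘(ℝ, EQ) 𝓘(ℝ, EP) (fun x => (f x).proj) x v ∈ H (f x).proj := by
  rw [(mem_cartanDistribution_iff hf x v).1 hv]
  exact (hmem x).2 _

lemma IsFibration.comp {E E' E'' X Y Z : Type*} [NormedAddCommGroup E] [NormedSpace ℝ E]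
    [NormedAddCommGroup E'] [NormedSpace ℝ E'] [NormedAddCommGroup E''] [NormedSpace ℝ E'']
    [TopologicalSpace X] [ChartedSpace E X] [TopologicalSpace Y] [ChartedSpace E' Y]
    [TopologicalSpace Z] [ChartedSpace E'' Z] {f : X → Y} {g : Y → Z}
    (hg : IsFibration E' E'' g) (hf : IsFibration E E' f) :
    IsFibration E E'' (fun x => g (f x)) where
  smooth := hg.smooth.comp hf.smooth
  surjective := hg.surjective.comp hf.surjective
  submersion x := by
    have h1 := mfderiv_comp (I := 𝓘(ℝ, E)) (I' := 𝓘(ℝ, E')) (I'' := 𝓘(ℝ, E'')) (f := f) (g := g) x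
      (hg.smooth.contMDiffAt.mdifferentiableAt (by simp))
      (hf.smooth.contMDiffAt.mdifferentiableAt (by simp))
    change Function.Surjective (mfderiv 𝓘(ℝ, E) 𝓘(ℝ, E'') (g ∘ f) x)
    rw [h1]
    exact (hg.submersion (f x)).comp (hf.submersion x)

end Jets

section AffineBundle

variable {EB : Type*} [NormedAddCommGroup EB] [NormedSpace ℝ EB]
  {B : Type*} [TopologicalSpace B] [ChartedSpace EB B]
  {F : Type*} [NormedAddCommGroup F] [NormedSpace ℝ F]
  {V : B → Type*} [TopologicalSpace (Bundle.TotalSpace F V)]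
  [∀ b, TopologicalSpace (V b)] [∀ b, AddCommGroup (V b)] [∀ b, Module ℝ (V b)]
  [FiberBundle F V]
  {EA : Type*} [NormedAddCommGroup EA] [NormedSpace ℝ EA]
  {A : Set (Bundle.TotalSpace F V)} [ChartedSpace EA A]

/-- The projection of an affine bundle is a surjective submersion, by its local sections. -/
theorem IsAffineBundle.isFibration {S : ∀ b, Submodule ℝ (V b)} (h : IsAffineBundle EB EA A S)
    (hs : ContMDiff 𝓘(ℝ, EA) 𝓘(ℝ, EB) ∞ (fun a : A => a.1.proj)) :
    IsFibration EA EB (fun a : A => a.1.proj) where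
  smooth := hs
  surjective b := by
    obtain ⟨ξ, hξ⟩ := h.nonempty b
    exact ⟨⟨_, hξ⟩, rfl⟩
  submersion a := by
    obtain ⟨U, hU, haU, k, s, e, he, Ψ, hΨ, hΨt, hΨ'⟩ := h.locally_trivial a.1.proj
    have ha : a ∈ Ψ.target := by rw [hΨt]; exact haU
    suffices hx : ∀ x ∈ Ψ.source, Function.Surjective
        (mfderiv 𝓘(ℝ, EA) 𝓘(ℝ, EB) (fun a : A => a.1.proj) (Ψ x)) by
      have h1 := hx _ (Ψ.map_target ha)
      have h2 : Ψ (Ψ.invFun a) = a := Ψ.right_inv ha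
      exact h2 ▸ h1
    rintro ⟨b, t⟩ hbt v
    have hb : b ∈ U := by rw [hΨ] at hbt; exact hbt.1
    have hσ : ContMDiffAt 𝓘(ℝ, EB) 𝓘(ℝ, EA) ∞ (fun b => Ψ (b, t)) b := by
      have h1 : ContMDiffAt (𝓘(ℝ, EB).prod 𝓘(ℝ, Fin k → ℝ)) 𝓘(ℝ, EA) ∞ Ψ (b, t) :=
        (Ψ.contMDiffOn _ hbt).contMDiffAt (Ψ.open_source.mem_nhds hbt)
      exact h1.comp b (contMDiffAt_id.prodMk contMDiffAt_const)
    have h1 := mfderiv_comp (I := 𝓘(ℝ, EB)) (I' := 𝓘(ℝ, EA)) (I'' := 𝓘(ℝ, EB))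
      (f := fun b => Ψ (b, t)) (g := fun a : A => a.1.proj) b
      (hs.contMDiffAt.mdifferentiableAt (by simp)) (hσ.mdifferentiableAt (by simp))
    have h2 : mfderiv 𝓘(ℝ, EB) 𝓘(ℝ, EB) ((fun a : A => a.1.proj) ∘ fun b => Ψ (b, t)) b =
        mfderiv 𝓘(ℝ, EB) 𝓘(ℝ, EB) id b := by
      refine Filter.EventuallyEq.mfderiv_eq ?_
      filter_upwards [hU.mem_nhds hb] with b' hb'
      simp [hΨ' b' hb']
    rw [h2, mfderiv_id] at h1
    exact ⟨mfderiv 𝓘(ℝ, EB) 𝓘(ℝ, EA) (fun b => Ψ (b, t)) b v, (congrArg (fun L => L v) h1).symm⟩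

end AffineBundle

/-! ### Involutivity of vertical bundles -/

section Involutive

variable {E : Type*} [NormedAddCommGroup E] [NormedSpace ℝ E] [CompleteSpace E]
  {X : Type*} [TopologicalSpace X] [ChartedSpace E X] [IsManifold 𝓘(ℝ, E) ∞ X]

/-- If the derivatives of a vector-valued function along two vector fields vanish, so does its
derivative along their bracket, by the symmetry of the second derivative. -/
lemma mfderiv_mlieBracket_eq_zero {F : Type*} [NormedAddCommGroup F] [NormedSpace ℝ F] {g : X → F}
    {x₀ : X} (hg : ContMDiffAt 𝓘(ℝ, E) 𝓘(ℝ, F) ∞ g x₀)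
    {V W : ∀ x : X, TangentSpace 𝓘(ℝ, E) x}
    (hV : MDifferentiableAt 𝓘(ℝ, E) 𝓘(ℝ, E).tangent
      (fun x => (⟨x, V x⟩ : TangentBundle 𝓘(ℝ, E) X)) x₀)
    (hW : MDifferentiableAt 𝓘(ℝ, E) 𝓘(ℝ, E).tangent
      (fun x => (⟨x, W x⟩ : TangentBundle 𝓘(ℝ, E) X)) x₀)
    (hgV : ∀ᶠ x in 𝓝 x₀, mfderiv 𝓘(ℝ, E) 𝓘(ℝ, F) g x (V x) = 0)
    (hgW : ∀ᶠ x in 𝓝 x₀, mfderiv 𝓘(ℝ, E) 𝓘(ℝ, F) g x (W x) = 0) :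
    mfderiv 𝓘(ℝ, E) 𝓘(ℝ, F) g x₀ (VectorField.mlieBracket 𝓘(ℝ, E) V W x₀) = 0 := by
  have : IsManifold 𝓘(ℝ, E) 2 X := IsManifold.of_le (n := ∞) (ENat.LEInfty.out)
  have : IsManifold 𝓘(ℝ, E) 1 X := IsManifold.of_le (n := ∞) ENat.LEInfty.out
  have : IsManifold 𝓘(ℝ, E) (minSmoothness ℝ 3) X := by
    rw [minSmoothness_of_isRCLikeNormedField]
    exact IsManifold.of_le (n := ∞) (ENat.LEInfty.out)
  let φ := extChartAt 𝓘(ℝ, E) x₀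
  let y₀ := φ x₀
  have hy₀ : φ.symm y₀ = x₀ := extChartAt_to_inv x₀
  have hy₀' : y₀ ∈ φ.target := mem_extChartAt_target x₀
  have hφ : ContMDiffAt 𝓘(ℝ, E) 𝓘(ℝ, E) ∞ φ.symm y₀ :=
    (contMDiffOn_extChartAt_symm (n := ∞) x₀).contMDiffAt (extChartAt_target_mem_nhds x₀)
  have hinv : ∀ y ∈ φ.target, (mfderiv 𝓘(ℝ, E) 𝓘(ℝ, E) φ.symm y).IsInvertible := fun y hy => by
    have := isInvertible_mfderivWithin_extChartAt_symm (I := 𝓘(ℝ, E)) hy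
    rwa [ModelWithCorners.range_eq_univ, mfderivWithin_univ] at this
  -- in the chart, the bracket is the bracket of the pulled back fields, annihilated by `Dh`
  let h : E → F := g ∘ φ.symm
  have hh : ContDiffAt ℝ ∞ h y₀ := by
    rw [← contMDiffAt_iff_contDiffAt]
    refine ContMDiffAt.comp y₀ ?_ hφ
    rwa [hy₀]
  have hlim : Filter.Tendsto φ.symm (𝓝 y₀) (𝓝 x₀) := by
    have := hφ.continuousAt.tendsto
    rwa [hy₀] at this
  have hgd : ∀ᶠ x in 𝓝 x₀, MDifferentiableAt 𝓘(ℝ, E) 𝓘(ℝ, F) g x :=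
    ((contMDiffAt_iff_contMDiffAt_nhds (by simp)).1
      (hg.of_le (m := 1) ENat.LEInfty.out)).mono
      fun x hx => hx.mdifferentiableAt (by simp)
  have hφd : ∀ᶠ y in 𝓝 y₀, MDifferentiableAt 𝓘(ℝ, E) 𝓘(ℝ, E) φ.symm y :=
    ((contMDiffAt_iff_contMDiffAt_nhds (by simp)).1
      (hφ.of_le (m := 1) ENat.LEInfty.out)).mono
      fun x hx => hx.mdifferentiableAt (by simp)
  have key : ∀ Z : ∀ x : X, TangentSpace 𝓘(ℝ, E) x, ∀ᶠ y in 𝓝 y₀,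
      fderiv ℝ h y (VectorField.mpullback 𝓘(ℝ, E) 𝓘(ℝ, E) φ.symm Z y) =
        mfderiv 𝓘(ℝ, E) 𝓘(ℝ, F) g (φ.symm y) (Z (φ.symm y)) := by
    intro Z
    filter_upwards [hlim.eventually hgd, hφd, extChartAt_target_mem_nhds x₀] with y h1 h2 h3
    have h4 := mfderiv_comp y h1 h2
    rw [mfderiv_eq_fderiv] at h4
    refine (congrArg (fun L : E →L[ℝ] F => L (VectorField.mpullback 𝓘(ℝ, E) 𝓘(ℝ, E) φ.symm Z y))
      h4).trans ?_
    change mfderiv 𝓘(ℝ, E) 𝓘(ℝ, F) g (φ.symm y) (mfderiv 𝓘(ℝ, E) 𝓘(ℝ, E) φ.symm y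
      ((mfderiv 𝓘(ℝ, E) 𝓘(ℝ, E) φ.symm y).inverse (Z (φ.symm y)))) = _
    obtain ⟨e, he⟩ := hinv y h3
    rw [← he]
    simp
  have hdiff : ∀ Z : ∀ x : X, TangentSpace 𝓘(ℝ, E) x, MDifferentiableAt 𝓘(ℝ, E) 𝓘(ℝ, E).tangent
      (fun x => (⟨x, Z x⟩ : TangentBundle 𝓘(ℝ, E) X)) x₀ →
      DifferentiableAt ℝ (VectorField.mpullback 𝓘(ℝ, E) 𝓘(ℝ, E) φ.symm Z) y₀ := by
    intro Z hZ
    have := (mdifferentiableWithinAt_univ.2 hZ).differentiableWithinAt_mpullbackWithin_vectorField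
    rw [ModelWithCorners.range_eq_univ, Set.preimage_univ, Set.univ_inter,
      VectorField.mpullbackWithin_univ] at this
    exact differentiableWithinAt_univ.1 this
  have hzero : ∀ Z : ∀ x : X, TangentSpace 𝓘(ℝ, E) x,
      (∀ᶠ x in 𝓝 x₀, mfderiv 𝓘(ℝ, E) 𝓘(ℝ, F) g x (Z x) = 0) →
      (fun y => fderiv ℝ h y (VectorField.mpullback 𝓘(ℝ, E) 𝓘(ℝ, E) φ.symm Z y)) =ᶠ[𝓝 y₀]
        fun _ => 0 := by
    intro Z hZ
    filter_upwards [key Z, hlim.eventually hZ] with y h1 h2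
    exact h1.trans h2
  have hbr := VectorField.fderiv_apply_lieBracket hh (by
    rw [minSmoothness_of_isRCLikeNormedField]; exact ENat.LEInfty.out) (hdiff W hW) (hdiff V hV)
  rw [(hzero V hgV).fderiv_eq, (hzero W hgW).fderiv_eq] at hbr
  have hpb := VectorField.mpullback_mlieBracket (I := 𝓘(ℝ, E)) (I' := 𝓘(ℝ, E)) (n := ∞)
    (f := φ.symm) (V := V) (W := W) (x₀ := y₀) (by rwa [hy₀]) (by rwa [hy₀]) hφ (by
      rw [minSmoothness_of_isRCLikeNormedField]; exact ENat.LEInfty.out)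
  rw [← VectorField.mlieBracketWithin_univ (V := VectorField.mpullback _ _ _ V),
    VectorField.mlieBracketWithin_eq_lieBracketWithin] at hpb
  replace hpb := hpb.trans (congrFun (VectorField.lieBracketWithin_univ (𝕜 := ℝ) (E := E)) y₀)
  have hfin := (key (VectorField.mlieBracket 𝓘(ℝ, E) V W)).self_of_nhds
  rw [hpb, hbr, hy₀] at hfin
  rw [← hfin, fderiv_fun_const]
  exact sub_zero (0 : F)

variable {E' : Type*} [NormedAddCommGroup E'] [NormedSpace ℝ E']
  {Y : Type*} [TopologicalSpace Y] [ChartedSpace E' Y] [IsManifold 𝓘(ℝ, E') ∞ Y]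

/-- The kernel of the differential of a smooth map is involutive. -/
theorem isInvolutive_vertical {f : X → Y} (hf : ContMDiff 𝓘(ℝ, E) 𝓘(ℝ, E') ∞ f) :
    IsInvolutive (vertical E E' f) := by
  intro U V W hU hV hW hfV hfW x₀ hx₀
  have : IsManifold 𝓘(ℝ, E') 1 Y := IsManifold.of_le (n := ∞) ENat.LEInfty.out
  -- composing `f` with a chart of `Y` makes it vector-valued and does not change the kernel
  let ψ := extChartAt 𝓘(ℝ, E') (f x₀)
  have hψ : ∀ᶠ x in 𝓝 x₀, f x ∈ ψ.source :=
    hf.continuous.continuousAt.eventually (extChartAt_source_mem_nhds (f x₀))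
  have hg : ContMDiffAt 𝓘(ℝ, E) 𝓘(ℝ, E') ∞ (ψ ∘ f) x₀ :=
    (contMDiffAt_extChartAt (n := ∞)).comp x₀ hf.contMDiffAt
  have hcomp : ∀ᶠ x in 𝓝 x₀, ∀ v : TangentSpace 𝓘(ℝ, E) x,
      mfderiv 𝓘(ℝ, E) 𝓘(ℝ, E') (ψ ∘ f) x v =
        mfderiv 𝓘(ℝ, E') 𝓘(ℝ, E') ψ (f x) (mfderiv 𝓘(ℝ, E) 𝓘(ℝ, E') f x v) := by
    filter_upwards [hψ] with x hx v
    have := mfderiv_comp x (I := 𝓘(ℝ, E)) (I' := 𝓘(ℝ, E')) (I'' := 𝓘(ℝ, E')) (f := f) (g := ψ)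
      (mdifferentiableAt_extChartAt (by rwa [extChartAt_source] at hx))
      (hf.contMDiffAt.mdifferentiableAt (by simp))
    exact congrArg (fun L => L v) this
  have hzero : ∀ Z : ∀ x : X, TangentSpace 𝓘(ℝ, E) x, (∀ x ∈ U, Z x ∈ vertical E E' f x) →
      ∀ᶠ x in 𝓝 x₀, mfderiv 𝓘(ℝ, E) 𝓘(ℝ, E') (ψ ∘ f) x (Z x) = 0 := by
    intro Z hZ
    filter_upwards [hcomp, hU.mem_nhds hx₀] with x h1 h2
    have h3 : mfderiv 𝓘(ℝ, E) 𝓘(ℝ, E') f x (Z x) = 0 := hZ x h2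
    rw [h1, h3, map_zero]
  have hdiff : ∀ Z : ∀ x : X, TangentSpace 𝓘(ℝ, E) x,
      ContMDiffOn 𝓘(ℝ, E) 𝓘(ℝ, E).tangent ∞ (fun p => (⟨p, Z p⟩ : TangentBundle 𝓘(ℝ, E) X)) U →
      MDifferentiableAt 𝓘(ℝ, E) 𝓘(ℝ, E).tangent
        (fun p => (⟨p, Z p⟩ : TangentBundle 𝓘(ℝ, E) X)) x₀ := fun Z hZ =>
    (hZ.contMDiffAt (hU.mem_nhds hx₀)).mdifferentiableAt (by simp)
  have h0 := mfderiv_mlieBracket_eq_zero hg (hdiff V hV) (hdiff W hW) (hzero V hfV) (hzero W hfW)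
  rw [hcomp.self_of_nhds] at h0
  obtain ⟨e, he⟩ := isInvertible_mfderiv_extChartAt (I := 𝓘(ℝ, E')) (mem_extChartAt_source (f x₀))
  change mfderiv 𝓘(ℝ, E') 𝓘(ℝ, E') (extChartAt 𝓘(ℝ, E') (f x₀)) (f x₀) _ = 0 at h0
  rw [← he] at h0
  exact e.map_eq_zero_iff.1 h0

end Involutive

/-! ### The Cartan distribution as a vector subbundle -/

/-- If `Z` is a section of `D` and `L` is surjective, then `(1 - Z D) L` has range `ker D`. -/
lemma finrank_ker_sub_section {E₁ E₂ E₃ : Type*} [AddCommGroup E₁] [Module ℝ E₁]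
    [AddCommGroup E₂] [Module ℝ E₂] [AddCommGroup E₃] [Module ℝ E₃] [FiniteDimensional ℝ E₁]
    [FiniteDimensional ℝ E₂] {L : E₁ →ₗ[ℝ] E₂} {D : E₂ →ₗ[ℝ] E₃}
    {Z : E₃ →ₗ[ℝ] E₂} (hL : Function.Surjective L) (hD : ∀ w, D (Z w) = w) :
    Module.finrank ℝ (LinearMap.ker (L - Z ∘ₗ D ∘ₗ L)) + Module.finrank ℝ E₂ =
      Module.finrank ℝ E₁ + Module.finrank ℝ E₃ := by
  have h1 := (L - Z ∘ₗ D ∘ₗ L).finrank_range_add_finrank_ker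
  have h2 := D.finrank_range_add_finrank_ker
  have h3 : LinearMap.range D = ⊤ := LinearMap.range_eq_top.2 fun w => ⟨Z w, hD w⟩
  have h4 : LinearMap.range (L - Z ∘ₗ D ∘ₗ L) = LinearMap.ker D := by
    apply le_antisymm
    · rintro _ ⟨v, rfl⟩
      change D (L v - Z (D (L v))) = 0
      rw [map_sub, hD, sub_self]
    · intro w hw
      obtain ⟨v, rfl⟩ := hL w
      refine ⟨v, ?_⟩
      change L v - Z (D (L v)) = L v
      rw [LinearMap.mem_ker.1 hw, map_zero, sub_zero]
  rw [h3, finrank_top] at h2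
  rw [h4] at h1
  omega

section Jets

variable {EM : Type*} [NormedAddCommGroup EM] [NormedSpace ℝ EM]
  {M : Type*} [TopologicalSpace M] [ChartedSpace EM M] [IsManifold 𝓘(ℝ, EM) ∞ M]
  {EP : Type*} [NormedAddCommGroup EP] [NormedSpace ℝ EP] [FiniteDimensional ℝ EP]
  {P : Type*} [TopologicalSpace P] [ChartedSpace EP P] [IsManifold 𝓘(ℝ, EP) ∞ P]
  {π : C^∞⟮𝓘(ℝ, EP), P; 𝓘(ℝ, EM), M⟯}
  {EQ : Type*} [NormedAddCommGroup EQ] [NormedSpace ℝ EQ] [FiniteDimensional ℝ EQ]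
  {Q : Type*} [TopologicalSpace Q] [ChartedSpace EQ Q]
  {f : Q → HomBundle π}

lemma finrank_cartanDistribution
    (hf : ContMDiff 𝓘(ℝ, EQ) (𝓘(ℝ, EP).prod 𝓘(ℝ, EM →L[ℝ] EP)) ∞ f)
    (hjet : ∀ x, f x ∈ jetBundle π)
    (hsub : ∀ x, Function.Surjective (mfderiv 𝓘(ℝ, EQ) 𝓘(ℝ, EP) (fun x => (f x).proj) x)) (x : Q) :
    Module.finrank ℝ (cartanDistribution EQ π f x) + Module.finrank ℝ EP =
      Module.finrank ℝ EQ + Module.finrank ℝ EM := by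
  let L : EQ →L[ℝ] EP := mfderiv 𝓘(ℝ, EQ) 𝓘(ℝ, EP) (fun x => (f x).proj) x
  let D : EP →L[ℝ] EM := mfderiv 𝓘(ℝ, EP) 𝓘(ℝ, EM) π (f x).proj
  let Z : EM →L[ℝ] EP := (f x).snd
  have hker : (cartanDistribution EQ π f x : Submodule ℝ EQ) =
      LinearMap.ker (L.toLinearMap - Z.toLinearMap ∘ₗ D.toLinearMap ∘ₗ L.toLinearMap) := by
    ext v
    exact (mem_cartanDistribution_iff hf x v).trans sub_eq_zero.symm
  have h := finrank_ker_sub_section (L := L.toLinearMap) (D := D.toLinearMap) (Z := Z.toLinearMap)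
    (hsub x) (hjet x)
  rw [← hker] at h
  exact h

/-- Where `pr` is a submersion, the Cartan distribution is a vector subbundle of the tangent
bundle. -/
theorem isVectorSubbundle_cartanDistribution [IsManifold 𝓘(ℝ, EQ) ∞ Q]
    (hf : ContMDiff 𝓘(ℝ, EQ) (𝓘(ℝ, EP).prod 𝓘(ℝ, EM →L[ℝ] EP)) ∞ f)
    (hjet : ∀ x, f x ∈ jetBundle π)
    (hsub : ∀ x, Function.Surjective (mfderiv 𝓘(ℝ, EQ) 𝓘(ℝ, EP) (fun x => (f x).proj) x)) :
    IsVectorSubbundle EQ EQ (cartanDistribution EQ π f) := by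
  refine ⟨Module.finrank ℝ EQ + Module.finrank ℝ EM - Module.finrank ℝ EP, fun x₀ => ?_⟩
  let p₀ := (f x₀).proj
  let eQ := trivializationAt EQ (TangentSpace 𝓘(ℝ, EQ) : Q → Type _) x₀
  let tP := trivializationAt EP (TangentSpace 𝓘(ℝ, EP) : P → Type _) p₀
  let tM := trivializationAt EM (TangentSpace 𝓘(ℝ, EM) : M → Type _) (π p₀)
  let tH := trivializationAt (EM →L[ℝ] EP) (HomFiber π) p₀
  let pr : Q → P := fun x => (f x).proj
  have hpr : ContMDiff 𝓘(ℝ, EQ) 𝓘(ℝ, EP) ∞ pr := contMDiff_proj_comp hf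
  let V : Set P := tP.baseSet ∩ π ⁻¹' tM.baseSet
  have hV : IsOpen V := tP.open_baseSet.inter (tM.open_baseSet.preimage π.contMDiff.continuous)
  let U : Set Q := eQ.baseSet ∩ pr ⁻¹' V
  have hU : IsOpen U := eQ.open_baseSet.inter (hV.preimage hpr.continuous)
  have hx₀ : x₀ ∈ U := ⟨FiberBundle.mem_baseSet_trivializationAt' x₀,
    FiberBundle.mem_baseSet_trivializationAt' p₀,
    show π p₀ ∈ tM.baseSet from FiberBundle.mem_baseSet_trivializationAt' (π p₀)⟩
  have hVH : ∀ p ∈ V, p ∈ tH.baseSet := fun p hp => by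
    rw [homFiber_baseSet]
    exact ⟨hp.2, hp.1⟩
  -- `d pr`, `dπ` and `ζ` in the trivializations
  let L : Q → EQ →L[ℝ] EP := fun x => (tP.continuousLinearMapAt ℝ (pr x)).comp
    ((mfderiv 𝓘(ℝ, EQ) 𝓘(ℝ, EP) pr x).comp (eQ.symmL ℝ x))
  let D : P → EP →L[ℝ] EM := fun p => (tM.continuousLinearMapAt ℝ (π p)).comp
    ((mfderiv 𝓘(ℝ, EP) 𝓘(ℝ, EM) π p).comp (tP.symmL ℝ p))
  let Z : Q → EM →L[ℝ] EP := fun x => tH.continuousLinearMapAt ℝ (pr x) (f x).snd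
  have hL : ContMDiffOn 𝓘(ℝ, EQ) 𝓘(ℝ, EQ →L[ℝ] EP) ∞ L U :=
    (contMDiffOn_mfderiv_trivialization hpr eQ tP).mono fun x hx => ⟨hx.1, hx.2.1⟩
  have hD : ContMDiffOn 𝓘(ℝ, EQ) 𝓘(ℝ, EP →L[ℝ] EM) ∞ (fun x => D (pr x)) U :=
    (contMDiffOn_mfderiv_trivialization π.contMDiff tP tM).comp hpr.contMDiffOn fun x hx => hx.2
  have hZ : ContMDiffOn 𝓘(ℝ, EQ) 𝓘(ℝ, EM →L[ℝ] EP) ∞ Z U := by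
    have h1 := (contMDiff_snd.comp_contMDiffOn (tH.contMDiffOn (IB := 𝓘(ℝ, EP)) (n := ∞))).comp
      hf.contMDiffOn (s := U) fun x hx => tH.mem_source.2 (hVH _ hx.2)
    refine h1.congr fun x hx => ?_
    change tH.continuousLinearMapAt ℝ (pr x) (f x).snd = (tH (f x)).2
    rw [tH.continuousLinearMapAt_apply (R := ℝ), tH.coe_linearMapAt_of_mem (hVH _ hx.2)]
  refine exists_isSmoothFrameOn_of_ker (W := EP) eQ hU Set.inter_subset_left hx₀
    (A := fun x => L x - (Z x).comp ((D (pr x)).comp (L x)))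
    (hL.sub (hZ.clm_comp (hD.clm_comp hL))) (fun x hx v => ?_) fun x _ => ?_
  · have h1 : L x (eQ.continuousLinearMapAt ℝ x v) =
        tP.continuousLinearMapAt ℝ (pr x) (mfderiv 𝓘(ℝ, EQ) 𝓘(ℝ, EP) pr x v) := by
      change tP.continuousLinearMapAt ℝ (pr x) (mfderiv 𝓘(ℝ, EQ) 𝓘(ℝ, EP) pr x
        (eQ.symmL ℝ x (eQ.continuousLinearMapAt ℝ x v))) = _
      rw [eQ.symmL_continuousLinearMapAt hx.1]
    have h2 : ∀ u, D (pr x) (tP.continuousLinearMapAt ℝ (pr x) u) =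
        tM.continuousLinearMapAt ℝ (π (pr x)) (mfderiv 𝓘(ℝ, EP) 𝓘(ℝ, EM) π (pr x) u) := fun u => by
      change tM.continuousLinearMapAt ℝ (π (pr x)) (mfderiv 𝓘(ℝ, EP) 𝓘(ℝ, EM) π (pr x)
        (tP.symmL ℝ (pr x) (tP.continuousLinearMapAt ℝ (pr x) u))) = _
      rw [tP.symmL_continuousLinearMapAt hx.2.1]
    have h3 : ∀ w, Z x (tM.continuousLinearMapAt ℝ (π (pr x)) w) =
        tP.continuousLinearMapAt ℝ (pr x) ((f x).snd w) := fun w => by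
      refine (homFiber_trivializationAt_apply π p₀ (pr x) (hVH _ hx.2) _ _).trans ?_
      rw [tM.symmL_continuousLinearMapAt hx.2.2]
    rw [mem_cartanDistribution_iff hf]
    change _ ↔ L x (eQ.continuousLinearMapAt ℝ x v) -
      Z x (D (pr x) (L x (eQ.continuousLinearMapAt ℝ x v))) = 0
    rw [h1, h2, h3, sub_eq_zero, ← tP.coe_continuousLinearEquivAt_eq hx.2.1]
    exact (tP.continuousLinearEquivAt ℝ (pr x) hx.2.1).injective.eq_iff.symm
  · have := finrank_cartanDistribution hf hjet hsub x
    omega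

end Jets

/-! ### Separation and countability of total spaces -/

section Topology

variable {B F : Type*} [TopologicalSpace B] [TopologicalSpace F] {V : B → Type*}
  [TopologicalSpace (Bundle.TotalSpace F V)] [∀ b, TopologicalSpace (V b)] [FiberBundle F V]

variable (F V) in
lemma t2Space_totalSpace [T2Space B] [T2Space F] : T2Space (Bundle.TotalSpace F V) := by
  refine ⟨fun ξ η hne => ?_⟩
  by_cases h : ξ.proj = η.proj
  · let e := trivializationAt F V ξ.proj
    have hξ : ξ ∈ e.source := FiberBundle.mem_trivializationAt_proj_source
    have hη : η ∈ e.source := by rw [e.mem_source, ← h, ← e.mem_source]; exact hξ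
    obtain ⟨u, v, hu, hv, hxu, hyv, huv⟩ := t2_separation (e.injOn.ne hξ hη hne)
    exact ⟨_, _, e.isOpen_inter_preimage hu, e.isOpen_inter_preimage hv, ⟨hξ, hxu⟩, ⟨hη, hyv⟩,
      (huv.preimage e).mono Set.inter_subset_right Set.inter_subset_right⟩
  · exact separated_by_continuous (FiberBundle.continuous_proj F V) h

variable (F V) in
lemma secondCountableTopology_totalSpace [SecondCountableTopology B] [SecondCountableTopology F] :
    SecondCountableTopology (Bundle.TotalSpace F V) := by
  obtain ⟨s, hs, hcov⟩ := TopologicalSpace.countable_cover_nhds fun b : B =>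
    (trivializationAt F V b).open_baseSet.mem_nhds (FiberBundle.mem_baseSet_trivializationAt' b)
  have := hs.to_subtype
  have (b : s) : SecondCountableTopology (trivializationAt F V (b : B)).source :=
    (trivializationAt F V (b : B)).toOpenPartialHomeomorph.secondCountableTopology_source
  refine TopologicalSpace.secondCountableTopology_of_countable_cover
    (U := fun b : s => (trivializationAt F V (b : B)).source)
    (fun b => (trivializationAt F V (b : B)).open_source) (Set.eq_univ_of_forall fun ξ => ?_)
  have h : ξ.proj ∈ ⋃ b ∈ s, (trivializationAt F V b).baseSet := hcov ▸ Set.mem_univ _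
  simp only [Set.mem_iUnion] at h ⊢
  obtain ⟨b, hb, h⟩ := h
  exact ⟨⟨b, hb⟩, (Bundle.Trivialization.mem_source _).2 h⟩

end Topology

end Pfaffian

theorem mainTheorem7
    {EM : Type*} [NormedAddCommGroup EM] [NormedSpace ℝ EM] [FiniteDimensional ℝ EM]
    {M : Type*} [TopologicalSpace M] [ChartedSpace EM M] [IsManifold 𝓘(ℝ, EM) ∞ M]
    [T2Space M] [SecondCountableTopology M]
    {EP : Type*} [NormedAddCommGroup EP] [NormedSpace ℝ EP] [FiniteDimensional ℝ EP]
    {P : Type*} [TopologicalSpace P] [ChartedSpace EP P] [IsManifold 𝓘(ℝ, EP) ∞ P]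
    [T2Space P] [SecondCountableTopology P]
    (π : C^∞⟮𝓘(ℝ, EP), P; 𝓘(ℝ, EM), M⟯)
    (H : ∀ p : P, Submodule ℝ (TangentSpace 𝓘(ℝ, EP) p))
    (hH : Pfaffian.IsPfaffianFibration EM π H) :
    -- `J¹_H P` is an embedded submanifold, an affine bundle and a Pfaffian fibration, and `pr` is
    -- a Pfaffian morphism
    (T2Space (Pfaffian.partialProlongation π H) ∧
      SecondCountableTopology (Pfaffian.partialProlongation π H) ∧
      ∃ (N : ℕ)
        (_ : ChartedSpace (EuclideanSpace ℝ (Fin N)) (Pfaffian.partialProlongation π H))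
        (_ : IsManifold (𝓡 N) ∞ (Pfaffian.partialProlongation π H)),
        Manifold.IsSmoothEmbedding (𝓡 N) (𝓘(ℝ, EP).prod 𝓘(ℝ, EM →L[ℝ] EP)) ∞
          (fun ξ : Pfaffian.partialProlongation π H => ξ.1) ∧
        Pfaffian.IsAffineBundle EP (EuclideanSpace ℝ (Fin N))
          (Pfaffian.partialProlongation π H)
          (Pfaffian.homInto π (Pfaffian.symbolSpace EM π H)) ∧
        Pfaffian.IsPfaffianFibration EM
          (fun ξ : Pfaffian.partialProlongation π H => π ξ.1.proj)
          (Pfaffian.cartanDistribution (EuclideanSpace ℝ (Fin N)) π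
            fun ξ : Pfaffian.partialProlongation π H => ξ.1) ∧
        Pfaffian.IsPfaffianMorphism
          (fun ξ : Pfaffian.partialProlongation π H => π ξ.1.proj)
          (Pfaffian.cartanDistribution (EuclideanSpace ℝ (Fin N)) π
            fun ξ : Pfaffian.partialProlongation π H => ξ.1)
          π H (fun ξ : Pfaffian.partialProlongation π H => ξ.1.proj)) ∧
    -- it contains every submanifold `f : Q → J¹P` on which `pr` is a Pfaffian morphism
    ∀ {EQ : Type*} [NormedAddCommGroup EQ] [NormedSpace ℝ EQ] [FiniteDimensional ℝ EQ]
      {Q : Type*} [TopologicalSpace Q] [ChartedSpace EQ Q] [IsManifold 𝓘(ℝ, EQ) ∞ Q]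
      (f : Q → Pfaffian.HomBundle π),
      Manifold.IsImmersion 𝓘(ℝ, EQ) (𝓘(ℝ, EP).prod 𝓘(ℝ, EM →L[ℝ] EP)) ∞ f →
      Function.Injective f →
      (∀ x, f x ∈ Pfaffian.jetBundle π) →
      Pfaffian.IsPfaffianMorphism (fun x => π (f x).proj)
        (Pfaffian.cartanDistribution EQ π f)
        π H (fun x => (f x).proj) →
      ∀ x, f x ∈ Pfaffian.partialProlongation π H := by
  obtain ⟨d, hd⟩ := Pfaffian.exists_isAdapted hH
  have h2 : T2Space (Pfaffian.HomBundle π) :=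
    Pfaffian.t2Space_totalSpace (EM →L[ℝ] EP) (Pfaffian.HomFiber π)
  have h3 : SecondCountableTopology (Pfaffian.HomBundle π) :=
    Pfaffian.secondCountableTopology_totalSpace (EM →L[ℝ] EP) (Pfaffian.HomFiber π)
  refine ⟨⟨inferInstance, inferInstance, Module.finrank ℝ EP + d, ?_⟩, ?_⟩
  · obtain ⟨hcs, hman, hemb⟩ := Pfaffian.exists_isSmoothEmbedding_partialProlongation hd
    have haff := Pfaffian.isAffineBundle_partialProlongation hd hemb
    have hsm := hemb.isImmersion.contMDiff
    have hjet : ∀ ξ : Pfaffian.partialProlongation π H, ξ.1 ∈ Pfaffian.jetBundle π :=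
      fun ξ => ξ.2.1
    have hpr := haff.isFibration (Pfaffian.contMDiff_proj_comp hsm)
    exact ⟨hcs, hman, hemb, haff,
      { isFibration := hH.isFibration.comp hpr
        isDistribution := Pfaffian.isVectorSubbundle_cartanDistribution hsm hjet hpr.submersion
        transversal := Pfaffian.vertical_sup_cartanDistribution hsm hjet hpr.submersion
        involutive := by
          rw [Pfaffian.symbolSpace_cartanDistribution hsm]
          exact Pfaffian.isInvolutive_vertical hpr.smooth },
      { isFibration := hpr
        comp_eq := rfl
        map_mem := fun ξ v hv =>
          Pfaffian.map_cartanDistribution_mem hsm (fun ξ => ξ.2) ξ hv }⟩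
  · intro EQ _ _ _ Q _ _ _ f hf _ hjet hφ
    exact Pfaffian.mem_partialProlongation_of_map_cartanDistribution hf.contMDiff hjet
      hφ.isFibration.submersion hφ.map_mem
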